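/- **Theorem 1.2** (Scherk-type normalized Hopf estimate). Let $0<p<q\le\pi$, put $A=\sin p$, $B=\sin(q-p)$, and let $\alpha\in(0,\pi)$ and $\beta\in(0,\pi/2)$ be given by $$\tan^2\frac{\alpha}{2}=\frac{A}{B},\qquad \tan\beta=\frac{\sin(q/2)}{\cos(p-q/2)} .$$ The points $$P_1=e^{i(q-p+2\beta)},\quad P_2=e^{-ip},\quad P_3=e^{i(p-q+2\beta)},\quad P_4=e^{ip}$$ are the vertices of a bicentric quadrilateral inscribed in the unit circle. For $z\in\mathbb D$ let $$f(z)=\sum_{j=1}^4\Omega_j(z)P_j,$$ where $\Omega_j(z)$ is the harmonic measure at $z$, with respect to the unit disk $\mathbb D$, of the $j$-th of the boundary arcs $\{e^{i\theta}:\theta\in I_j\}$, $I_1=(0,\alpha)$, $I_2=(\alpha,\pi)$, $I_3=(\pi,\pi+\alpha)$, $I_4=(\pi+\alpha,2\pi)$. Call $(p,q)$ admissible if $0\in f(\mathbb D)$, that is, if there is $z_\circ\in\mathbb D$ with $f(z_\circ)=0$. A Scherk-type comparison graph with parameters $(p,q)$ is the graph of a $C^2$ solution $u$ of the minimal surface equation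 on $f(\mathbb D)$ for which $z\mapsto (f(z),u(f(z)))$ is a conformal parametrization over $\mathbb D$. Then for every admissible pair $(p,q)$ and every Scherk-type comparison graph with parameters $(p,q)$, at the point of the graph above the center $0=f(z_\circ)$, $$W^2|K|\le\frac{\pi^2}{2},$$ where $W=\sqrt{1+|\nabla u|^2}$ and $K$ is the Gauss curvature of the graph. -/

import Mathlib

open Real

noncomputable section

/-! The plane is identified with `ℂ`; a graph is given by a height function `u : ℂ → ℝ`. -/

namespace Scherk

/-- The partial derivative of `F` in the first coordinate direction (the direction `1`). -/
def dx {E : Type*} [NormedAddCommGroup E] [NormedSpace ℝ E] (F : ℂ → E) (w : ℂ) : E :=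
  fderiv ℝ F w 1

/-- The partial derivative of `F` in the second coordinate direction (the direction `i`). -/
def dy {E : Type*} [NormedAddCommGroup E] [NormedSpace ℝ E] (F : ℂ → E) (w : ℂ) : E :=
  fderiv ℝ F w Complex.I

/-- The inclination factor `W = √(1 + |∇u|²)` of the graph of `u`, at the point above `w`. -/
def slopeFactor (u : ℂ → ℝ) (w : ℂ) : ℝ :=
  √(1 + (dx u w) ^ 2 + (dy u w) ^ 2)

/-- The Gauss curvature `K = (u_xx u_yy - u_xy²) / (1 + |∇u|²)²` of the graph of `u`, at the
point above `w`. -/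
def gaussCurvature (u : ℂ → ℝ) (w : ℂ) : ℝ :=
  (dx (dx u) w * dy (dy u) w - (dy (dx u) w) ^ 2) / (1 + (dx u w) ^ 2 + (dy u w) ^ 2) ^ 2

/-- The minimal surface equation
`(1 + u_y²) u_xx - 2 u_x u_y u_xy + (1 + u_x²) u_yy = 0` at the point `w`. -/
def MinimalSurfaceEquation (u : ℂ → ℝ) (w : ℂ) : Prop :=
  (1 + (dy u w) ^ 2) * dx (dx u) w - 2 * dx u w * dy u w * dy (dx u) w
    + (1 + (dx u w) ^ 2) * dy (dy u) w = 0

/-- The harmonic measure at `z`, with respect to the unit disk, of the boundary arc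
`{e^{iθ} : a < θ < b}`: the Poisson integral of its indicator function. -/
def harmonicMeasure (a b : ℝ) (z : ℂ) : ℝ :=
  (2 * π)⁻¹ * ∫ θ in a..b, poissonKernel 0 z (circleMap 0 1 θ)

/-- The arc parameter: the `α ∈ (0, π)` with `tan² (α / 2) = sin p / sin (q - p)`. -/
def arcParam (p q : ℝ) : ℝ :=
  2 * arctan √(sin p / sin (q - p))

/-- The angle `β ∈ (0, π / 2)` with `tan β = sin (q / 2) / cos (p - q / 2)`. The inscribed
quadrilateral with the vertices `vertex₁, …, vertex₄` below satisfies
`|P₁ - P₂| + |P₃ - P₄| = |P₂ - P₃| + |P₄ - P₁|`, that is, it has an inscribed circle too,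
for exactly this `β`. -/
def betaParam (p q : ℝ) : ℝ :=
  arctan (sin (q / 2) / cos (p - q / 2))

/-- `P₁ = e^{i(q - p + 2β)}`. The points `P₁, P₂, P₃, P₄` lie on the unit circle, in this
counterclockwise order, and are the vertices of the bicentric quadrilateral of `(p, q)`. -/
def vertex₁ (p q : ℝ) : ℂ := circleMap 0 1 (q - p + 2 * betaParam p q)

/-- `P₂ = e^{-ip}`. -/
def vertex₂ (p _q : ℝ) : ℂ := circleMap 0 1 (-p)

/-- `P₃ = e^{i(p - q + 2β)}`. -/
def vertex₃ (p q : ℝ) : ℂ := circleMap 0 1 (p - q + 2 * betaParam p q)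

/-- `P₄ = e^{ip}`. -/
def vertex₄ (p _q : ℝ) : ℂ := circleMap 0 1 p

/-- The horizontal projection in fixed-arc normalization: the harmonic extension to the disk of
the boundary function with the constant values `P₁, P₂, P₃, P₄` on the arcs
`(0, α), (α, π), (π, π + α), (π + α, 2π)`. -/
def projection (p q : ℝ) (z : ℂ) : ℂ :=
  harmonicMeasure 0 (arcParam p q) z * vertex₁ p q
    + harmonicMeasure (arcParam p q) π z * vertex₂ p q
    + harmonicMeasure π (π + arcParam p q) z * vertex₃ p q
    + harmonicMeasure (π + arcParam p q) (2 * π) z * vertex₄ p q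

/-- The domain of the Scherk-type graphs of `(p, q)`: the image of the open unit disk under the
horizontal projection (the interior of the quadrilateral with the vertices `P₁, …, P₄`). -/
def domain (p q : ℝ) : Set ℂ :=
  projection p q '' Metric.ball 0 1

/-- The pair `(p, q)` is admissible: the center `0` lies in the domain of the graph, that is,
the horizontal projection has a zero in the unit disk. -/
def Admissible (p q : ℝ) : Prop :=
  0 < p ∧ p < q ∧ q ≤ π ∧ (0 : ℂ) ∈ domain p q

/-- The parametrization `z ↦ (f z, t z) ∈ ℂ × ℝ = ℝ³` is conformal at `z`: its two partial
derivatives have the same length and are orthogonal. -/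
def ConformalParam (f : ℂ → ℂ) (t : ℂ → ℝ) (z : ℂ) : Prop :=
  ‖dx f z‖ ^ 2 + (dx t z) ^ 2 = ‖dy f z‖ ^ 2 + (dy t z) ^ 2 ∧
    inner ℝ (dx f z) (dy f z) + dx t z * dy t z = 0

/-- The graph of `u` over `domain p q` is a Scherk-type comparison graph with parameters
`(p, q)`: it is a minimal graph, and the variable `z` of the unit disk is a conformal
(isothermal) parameter on it for which `projection p q` is the horizontal projection. -/
structure IsScherkGraph (p q : ℝ) (u : ℂ → ℝ) : Prop where
  contDiffAt : ∀ w ∈ domain p q, ContDiffAt ℝ 2 u w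
  minimal : ∀ w ∈ domain p q, MinimalSurfaceEquation u w
  conformal : ∀ z ∈ Metric.ball (0 : ℂ) 1,
    ConformalParam (projection p q) (fun ζ => u (projection p q ζ)) z

end Scherk

end

noncomputable section

open scoped ComplexConjugate

namespace Scherk

/-! Put `H = f_z` and `G = conj f_{z̄}`. Both are rational with simple poles at the jump points `±1,
±a`, `a = e^{iα}`. The choice of `α` and `β` makes the numerator of `H` a perfect square
(`BicentricData.coeff₁_sq`), and the numerator of `G` is its conjugate reversal
(`BicentricData.coeff_conj`). Hence `G = H Q²` with a disk automorphism `Q`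
(`BicentricData.exists_gaussMap`). Conformality gives the gradient of `u` up to sign in terms of
`Q`, so that `W²|K| (|H|(1 - |Q|⁴))² = 4|Q'|²`. Equality in Schwarz–Pick turns this into `W²|K|
((|H| + |G|)(1 - |z|²))² = 4` (`curvature_mul_sq_conformalFactor`). The claim becomes `8 ≤ π² ((|H|
+ |G|)(1 - |z|²))²` at a zero of `f` (`BicentricData.eight_le`).

For this bound, a disk automorphism moves the zero to the center. The jump points become unit
vectors `w_j`, consecutive ones separated by angles `2x_j` with `x_j = π Ω_j(z)`. Then `H` and `G`
are sums of the `w_j` weighted by the sides of the quadrilateral, and `HG` is minus the square of an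
alternating sum weighted by the side lengths. So `(|H| + |G|)²` is a quadratic form in the `w_j`;
the products of opposite `w_j` have nonnegative coefficients and are replaced by `-1`
(`BicentricData.energy_lower_bound`). What is left exceeds the value of the square by a positive
multiple of `energyExcess`.

The equation `f(z) = 0` expresses `D = x₂ - x₄` and `E = x₃ - x₁` through `Y = x₂ + x₄`
(`BicentricData.balance`). It remains to prove the real inequality `energyExcess_nonneg'`. By
symmetry `Y ≤ π/2`, and Jordan-type estimates for the light pair (weight `Y`) and the heavy pair
(weight `π - Y`) suffice. -/

/-! ### Elementary trigonometric inequalities -/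

theorem half_sq_le_one_sub_cos {x : ℝ} (h0 : 0 ≤ x) (h1 : x ≤ π / 2) :
    4 * x ^ 2 / π ^ 2 ≤ 1 - cos x := by
  have hp := pi_pos
  -- The chord of `sin` over `[0, π/4]` lies below the graph; equality at `x = π/2` fixes the
  -- constant.
  have key : √2 * (x / π) ≤ sin (x / 2) := by
    have m0 : (0 : ℝ) ∈ Set.Icc 0 π := ⟨le_refl _, hp.le⟩
    have m1 : π / 4 ∈ Set.Icc 0 π := ⟨by positivity, by linarith⟩
    have w0 : 0 ≤ 1 - 2 * x / π := by rw [sub_nonneg, div_le_one hp]; linarith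
    have w1 : 0 ≤ 2 * x / π := by positivity
    have h := strictConcaveOn_sin_Icc.concaveOn.right m0 m1 w0 w1 (by ring)
    simp only [smul_eq_mul, mul_zero, sin_zero, zero_add, sin_pi_div_four] at h
    have e : 2 * x / π * (π / 4) = x / 2 := by field_simp; ring
    rw [e] at h
    calc √2 * (x / π) = 2 * x / π * (√2 / 2) := by ring
      _ ≤ _ := h
  have h2 : cos x = 1 - 2 * sin (x / 2) ^ 2 := by
    have h := cos_two_mul (x / 2)
    rw [cos_sq', mul_div_cancel₀ x two_ne_zero] at h
    linarith
  have h3 : (√2 * (x / π)) ^ 2 ≤ sin (x / 2) ^ 2 := by gcongr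
  rw [mul_pow, Real.sq_sqrt (by norm_num), div_pow] at h3
  rw [h2]
  calc 4 * x ^ 2 / π ^ 2 = 2 * (2 * (x ^ 2 / π ^ 2)) := by ring
    _ ≤ _ := by linarith

theorem mul_cos_le_sin {x : ℝ} (h0 : 0 ≤ x) (h1 : x ≤ π / 2) : x * cos x ≤ sin x := by
  rcases h1.eq_or_lt with rfl | h
  · simp
  · have hc : 0 < cos x := cos_pos_of_mem_Ioo ⟨by linarith [pi_pos], h⟩
    have := le_tan h0 h
    rwa [tan_eq_sin_div_cos, le_div_iff₀ hc] at this

theorem two_div_pi_mul_le_sin {x : ℝ} (h0 : 0 ≤ x) (h1 : x ≤ π / 2) : 2 * x ≤ π * sin x := by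
  have := mul_le_sin h0 h1
  have hp := pi_pos
  rw [div_mul_eq_mul_div, div_le_iff₀ hp] at this
  linarith

/-! ### Algebraic criterion for the position of the center -/

/-- The weights of the balanced configuration can be nonnegative only if the center lies inside
the quadrilateral. -/
theorem sum_le_one_add_mul_cos {S T c k : ℝ} (hS : 0 ≤ S) (hc : 0 < c) (hk : 0 < k)
    (hSc : S ^ 2 + c ^ 2 = 1) (hTk : T ^ 2 + k ^ 2 = 1)
    (h : T ^ 2 * (1 + S) ≤ (1 - S) * (1 + c * k)) : S + T + S * T ≤ 1 + c * k := by
  by_contra! hn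
  have hck : 0 < c * k := by positivity
  have hS1 : S < 1 := by nlinarith
  have h1 : T ^ 2 * (1 + S) ^ 2 ≤ c ^ 2 * (1 + c * k) := by nlinarith
  -- With `n = 1 + ck` the last factor is `(n - S)² - c²n`. Thus `T²(1 + S)² ≤ c²n` forces `c²n ≤ (n
  -- - S)²`, and chaining the two gives the square of the claim.
  have hb : (c ^ 2 * (c ^ 2 * (1 + c * k) - T ^ 2 * (1 + S) ^ 2)) = (1 + S) ^ 2 *
      ((1 + c * k) ^ 2 - (1 + c * k) * (1 + 2 * S - S ^ 2) + S ^ 2) := by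
    have e1 : c ^ 2 = 1 - S ^ 2 := by linarith
    have e2 : T ^ 2 = 1 - k ^ 2 := by linarith
    rw [e2, show c ^ 2 * (c ^ 2 * (1 + c * k) - (1 - k ^ 2) * (1 + S) ^ 2) =
      c ^ 2 * (c ^ 2 * (1 + c * k)) - (c ^ 2 - (c * k) ^ 2) * (1 + S) ^ 2 by ring, e1]
    ring
  have hb0 : 0 ≤ (1 + c * k) ^ 2 - (1 + c * k) * (1 + 2 * S - S ^ 2) + S ^ 2 := by
    by_contra! hneg
    have : (1 + S) ^ 2 * ((1 + c * k) ^ 2 - (1 + c * k) * (1 + 2 * S - S ^ 2) + S ^ 2) < 0 :=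
      mul_neg_of_pos_of_neg (by positivity) hneg
    have : 0 ≤ c ^ 2 * (c ^ 2 * (1 + c * k) - T ^ 2 * (1 + S) ^ 2) :=
      mul_nonneg (by positivity) (by linarith)
    linarith
  have h2 : (1 + c * k - S) ^ 2 < (T * (1 + S)) ^ 2 := by
    apply pow_lt_pow_left₀ _ _ (by norm_num) <;> nlinarith
  nlinarith

/-- The identity of `sum_le_one_add_mul_cos` read backwards. The condition on `S + T + ST` is
symmetric in the two pairs, so the two lemmas carry the criterion from one pair to the other. -/
theorem sq_mul_le_of_sum_le {S T c k : ℝ} (hS : 0 ≤ S) (hT : 0 ≤ T) (hc : 0 < c) (hk : 0 < k)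
    (hSc : S ^ 2 + c ^ 2 = 1) (hTk : T ^ 2 + k ^ 2 = 1)
    (h : S + T + S * T ≤ 1 + c * k) : T ^ 2 * (1 + S) ≤ (1 - S) * (1 + c * k) := by
  have hck : 0 < c * k := by positivity
  have hS1 : S < 1 := by nlinarith
  by_contra! hn
  have h1 : c ^ 2 * (1 + c * k) < T ^ 2 * (1 + S) ^ 2 := by nlinarith
  have hb : (c ^ 2 * (c ^ 2 * (1 + c * k) - T ^ 2 * (1 + S) ^ 2)) = (1 + S) ^ 2 *
      ((1 + c * k) ^ 2 - (1 + c * k) * (1 + 2 * S - S ^ 2) + S ^ 2) := by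
    have e1 : c ^ 2 = 1 - S ^ 2 := by linarith
    have e2 : T ^ 2 = 1 - k ^ 2 := by linarith
    rw [e2, show c ^ 2 * (c ^ 2 * (1 + c * k) - (1 - k ^ 2) * (1 + S) ^ 2) =
      c ^ 2 * (c ^ 2 * (1 + c * k)) - (c ^ 2 - (c * k) ^ 2) * (1 + S) ^ 2 by ring, e1]
    ring
  have h2 : (T * (1 + S)) ^ 2 ≤ (1 + c * k - S) ^ 2 := by
    apply pow_le_pow_left₀ (by positivity); linarith
  have hb0 : 0 < (1 + c * k) ^ 2 - (1 + c * k) * (1 + 2 * S - S ^ 2) + S ^ 2 := by nlinarith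
  have h3 : 0 < (1 + S) ^ 2 *
      ((1 + c * k) ^ 2 - (1 + c * k) * (1 + 2 * S - S ^ 2) + S ^ 2) := by positivity
  have h4 : c ^ 2 * (c ^ 2 * (1 + c * k) - T ^ 2 * (1 + S) ^ 2) < 0 :=
    mul_neg_of_pos_of_neg (by positivity) (by linarith)
  linarith

/-! ### Energy estimates for the two pairs of opposite vertices -/

/-- Lower bound for the part of the energy carried by the vertices with total weight at most
one half. -/
theorem light_pair_bound {S Y D : ℝ} (hS : 0 ≤ S) (hY0 : 0 ≤ Y) (hY : Y ≤ π / 2)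
    (hD : S * (π - Y) ≤ D) (hD2 : D ≤ π / 2) :
    2 * S ^ 2 - cos Y ≤ 2 * S * sin Y * sin D - (1 + S ^ 2) * cos Y * cos D := by
  have hp := pi_pos
  have hD0 : 0 ≤ D := le_trans (by nlinarith) hD
  -- In this variable Jordan's inequality reads `1 - w ≤ sin Y` and `w ≤ cos Y`, and all bounds
  -- become polynomial in `S` and `w`.
  obtain ⟨w, hw⟩ : ∃ w, w = 1 - 2 * Y / π := ⟨_, rfl⟩
  have hYw : Y = π / 2 * (1 - w) := by rw [hw]; field_simp; ring
  have hw0 : 0 ≤ w := by rw [hw, sub_nonneg, div_le_one hp]; linarith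
  have hw1 : w ≤ 1 := by rw [hw]; have : 0 ≤ 2 * Y / π := by positivity
                         linarith
  have hDw : S * (1 + w) ≤ 2 * D / π := by
    rw [le_div_iff₀ hp]; rw [hYw] at hD; nlinarith
  have s1 : S * (1 + w) ≤ sin D := by
    have := two_div_pi_mul_le_sin hD0 hD2
    refine hDw.trans ?_
    rw [div_le_iff₀ hp]; linarith
  have c1 : cos D ≤ 1 - (S * (1 + w)) ^ 2 := by
    have h1 := half_sq_le_one_sub_cos hD0 hD2
    have h2 : (S * (1 + w)) ^ 2 ≤ (2 * D / π) ^ 2 := by gcongr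
    have h3 : (2 * D / π) ^ 2 = 4 * D ^ 2 / π ^ 2 := by ring
    linarith
  have s2 : 1 - w ≤ sin Y := by
    have := two_div_pi_mul_le_sin hY0 hY
    rw [hYw] at this
    rw [hYw]; nlinarith
  have c2 : w ≤ cos Y := by
    have := two_div_pi_mul_le_sin (x := π / 2 - Y) (by linarith) (by linarith)
    rw [sin_pi_div_two_sub] at this
    nlinarith
  have hA : S ^ 2 * (1 - w) * (1 + w) ≤ S * sin Y * sin D := by
    calc S ^ 2 * (1 - w) * (1 + w) = (S * (1 - w)) * (S * (1 + w)) := by ring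
      _ ≤ (S * sin Y) * sin D := by
        apply mul_le_mul _ s1 (by positivity)
        · exact mul_nonneg hS (by linarith)
        · gcongr
  have hB : S ^ 2 * (2 * w + w ^ 2) ≤ 1 - (1 + S ^ 2) * cos D := by
    nlinarith [mul_le_mul_of_nonneg_left c1 (by positivity : 0 ≤ 1 + S ^ 2),
      mul_nonneg (sq_nonneg (S * (1 + w))) (sq_nonneg S)]
  have hC : w * (S ^ 2 * (2 * w + w ^ 2)) ≤ cos Y * (1 - (1 + S ^ 2) * cos D) := by
    apply mul_le_mul c2 hB (by positivity) (by linarith)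
  have : 0 ≤ w * S ^ 2 * w ^ 2 := by positivity
  nlinarith

/-- Squaring `S(π - Y) ≤ Y` gives `πS²(π - 2Y) ≤ (1 - S²)Y²`; combine with `cos Y ≤ π/2 - Y`. -/
theorem cos_mul_sq_le {S Y : ℝ} (hS : 0 ≤ S) (hY : Y ≤ π / 2)
    (hSY : S * (π - Y) ≤ Y) : cos Y * π * S ^ 2 ≤ (1 - S ^ 2) * Y ^ 2 / 2 := by
  have hp := pi_pos
  have hc : cos Y ≤ (π - 2 * Y) / 2 := by
    rw [← sin_pi_div_two_sub]
    exact (sin_le (by linarith)).trans (by linarith)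
  have h1 : (S * (π - Y)) ^ 2 ≤ Y ^ 2 :=
    pow_le_pow_left₀ (mul_nonneg hS (by linarith)) hSY 2
  have : cos Y * (π * S ^ 2) ≤ (π - 2 * Y) / 2 * (π * S ^ 2) := by gcongr
  nlinarith

/-- With `a = S²`, `b = T²`, `g = ck`, `q = w = 1 - cos Y` this is what the pair bounds leave of the
energy excess when `S ≤ T`. After replacing `w` by `q` it is affine in `q`, so the endpoints `q = 1`
and `q = 1.5a` decide. The bound `0.146` rounds up `((3 - √5)/2)²`. -/
theorem golden_polynomial_bound {a b g : ℝ} (ha : 0 ≤ a) (hab : a ≤ b) (hb : b ≤ 1)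
    (hp : a * b ≤ 0.146) (hg0 : 1 - b ≤ g) (hg1 : 2 * g ≤ 2 - (a + b)) {q w : ℝ}
    (hw : q ≤ w) (hq0 : 1.5 * a ≤ q) (hq1 : q ≤ 1) {m : ℝ} (hm : m = 1 - a + g) :
    0 ≤ a * (2 * (1 - b) + g) + (b - a) * (1 - q) + b * (w * m - g - a * (2 + 1.08 * q)) := by
  have hg : 0 ≤ g := by linarith
  have hm0 : 0 ≤ m := by rw [hm]; linarith
  have hb0 : 0 ≤ b := ha.trans hab
  have hwm : b * (q * m) ≤ b * (w * m) := by gcongr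
  have e1 : 0 ≤ a * (2 * (1 - b) + g) + b * (m - g - a * 3.08) := by
    rw [hm]
    have : 0 ≤ a * g := by positivity
    nlinarith [sq_nonneg (2 * a - b), sq_nonneg (a - 0.27), sq_nonneg (b - 0.54)]
  have ha2 : a ≤ 0.3825 := by nlinarith
  have p1 : 0 ≤ a * (0.146 - a * b) := mul_nonneg ha (by linarith)
  have p2 : 0 ≤ (a * b) * (1 - b) := mul_nonneg (by positivity) (by linarith)
  -- At `q = 1.5a` the expression is affine in `g` with slope `a - b + 1.5ab`; `u1` and `u2` are its
  -- values at the extremes `g = 1 - b` and `g = 1 - (a + b)/2`.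
  have u1 : 0 ≤ a + b + (1 - b) * (a - b + 1.5 * a * b) - 4 * a * b + 1.5 * a ^ 2
      - 3.12 * a ^ 2 * b := by
    nlinarith [sq_nonneg (b - 2.5 * a), mul_nonneg ha (sub_nonneg.2 ha2)]
  have u2 : 0 ≤ a + b + (1 - (a + b) / 2) * (a - b + 1.5 * a * b) - 4 * a * b + 1.5 * a ^ 2
      - 3.12 * a ^ 2 * b := by
    nlinarith [sq_nonneg (b - 3.25 * a), mul_nonneg ha (sub_nonneg.2 ha2)]
  have e2 : 0 ≤ a * (2 * (1 - b) + g) + (b - a) * (1 - 1.5 * a)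
      + b * (1.5 * a * m - g - a * (2 + 1.08 * (1.5 * a))) := by
    rw [hm]
    rcases le_total 0 (a - b + 1.5 * a * b) with h | h
    · nlinarith [mul_le_mul_of_nonneg_right hg0 h]
    · nlinarith [mul_le_mul_of_nonpos_right hg1 h]
  have ha3 : 0 < 1 - 1.5 * a := by linarith
  have comb : (1 - 1.5 * a) * (a * (2 * (1 - b) + g) + (b - a) * (1 - q)
      + b * (q * m - g - a * (2 + 1.08 * q))) =
      (1 - q) * (a * (2 * (1 - b) + g) + (b - a) * (1 - 1.5 * a)
      + b * (1.5 * a * m - g - a * (2 + 1.08 * (1.5 * a)))) +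
      (q - 1.5 * a) * (a * (2 * (1 - b) + g) + b * (m - g - a * 3.08)) := by ring
  have : 0 ≤ (1 - 1.5 * a) * (a * (2 * (1 - b) + g) + (b - a) * (1 - q)
      + b * (q * m - g - a * (2 + 1.08 * q))) := by
    rw [comb]
    exact add_nonneg (mul_nonneg (by linarith) e2) (mul_nonneg (by linarith) e1)
  have := nonneg_of_mul_nonneg_right this ha3
  linarith

/-- A lower bound for the energy of the heavier pair of vertices, relative to the value `cos Y`
of the trivial configuration, when the heavier pair is the more eccentric one. -/
theorem heavy_pair_bound_of_le {S T c Y E M : ℝ} (hT : 0 ≤ T)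
    (hY0 : 0 ≤ Y) (hY : Y ≤ π / 2) (hM0 : 0 < M) (hMc : 2 * c ^ 2 ≤ M)
    (hcs : cos Y * π * S ^ 2 ≤ c ^ 2 * Y ^ 2 / 2)
    (hE : E * M = T * (Y * M + π * S ^ 2)) (hE0 : 0 ≤ E) (hE2 : E ≤ π / 2) :
    cos Y ≤ 2 * T * sin Y * sin E + (1 + T ^ 2) * cos Y * cos E := by
  have hp := pi_pos
  have hpi : π < 3.1416 := pi_lt_d4
  have hC0 : 0 ≤ cos Y := cos_nonneg_of_neg_pi_div_two_le_of_le (by linarith) hY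
  have hs0 : 0 ≤ sin Y := sin_nonneg_of_nonneg_of_le_pi hY0 (by linarith)
  have hYC := mul_cos_le_sin hY0 hY
  have hYs := two_div_pi_mul_le_sin hY0 hY
  have hEs := two_div_pi_mul_le_sin hE0 hE2
  have hEc : 1 - E ^ 2 / 2 ≤ cos E := one_sub_sq_div_two_le_cos
  have hEc0 : 0 ≤ cos E := cos_nonneg_of_neg_pi_div_two_le_of_le (by linarith) hE2
  have hY2 : Y ^ 2 ≤ π ^ 2 * sin Y / 4 := by nlinarith
  have hpi3 : π + π ^ 3 / 16 ≤ 8 := by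
    have : π ^ 3 ≤ 3.1416 ^ 3 := by gcongr
    norm_num at this; linarith
  -- By `sin E ≥ 2E/π` and `cos E ≥ 1 - E²/2` it is enough that `πE cos Y ≤ 8T sin Y`. In view of
  -- `hE` this follows on multiplying the present line by `T` and cancelling `M`.
  have k1 : π * (cos Y * (Y * M + π * S ^ 2)) ≤ 8 * sin Y * M := by
    have a1 : cos Y * (Y * M) ≤ sin Y * M := by nlinarith
    have a2 : cos Y * (π * S ^ 2) ≤ M * Y ^ 2 / 4 := by nlinarith [sq_nonneg Y]
    have a3 : M * Y ^ 2 / 4 ≤ M * (π ^ 2 * sin Y / 4) / 4 := by gcongr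
    calc π * (cos Y * (Y * M + π * S ^ 2))
        ≤ π * (sin Y * M + M * (π ^ 2 * sin Y / 4) / 4) := by gcongr; linarith
      _ = (π + π ^ 3 / 16) * (sin Y * M) := by ring
      _ ≤ 8 * (sin Y * M) := by gcongr
      _ = _ := by ring
  have k2 : M * (π * (cos Y * E)) ≤ M * (8 * T * sin Y) := by
    calc M * (π * (cos Y * E)) = π * (cos Y * (E * M)) := by ring
      _ = T * (π * (cos Y * (Y * M + π * S ^ 2))) := by rw [hE]; ring
      _ ≤ T * (8 * sin Y * M) := by gcongr
      _ = _ := by ring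
  have k3 := le_of_mul_le_mul_left k2 hM0
  have k4 : cos Y * E ^ 2 / 2 ≤ 2 * T * sin Y * sin E := by
    have b1 : E * (π * (cos Y * E)) ≤ E * (8 * T * sin Y) := by gcongr
    have b2 : T * sin Y * (2 * E) ≤ T * sin Y * (π * sin E) := by gcongr
    have : π * (cos Y * E ^ 2 / 2) ≤ π * (2 * T * sin Y * sin E) := by linarith
    exact le_of_mul_le_mul_left this hp
  have k5 : cos Y * (1 - E ^ 2 / 2) ≤ cos Y * cos E := by gcongr
  have k6 : 0 ≤ T ^ 2 * (cos Y * cos E) := by positivity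
  linarith

/-- A lower bound for the energy of the heavier pair of vertices, relative to the value `cos Y`
of the trivial configuration. -/
theorem heavy_pair_bound {S T c Y E M : ℝ} (hT : 0 ≤ T)
    (hY0 : 0 ≤ Y) (hY : Y ≤ π / 2) (hM0 : 0 < M) (hMc : c ^ 2 ≤ M)
    (hcs : cos Y * π * S ^ 2 ≤ c ^ 2 * Y ^ 2 / 2)
    (hE : E * M = T * (Y * M + π * S ^ 2)) (hE0 : 0 ≤ E) (hE2 : E ≤ π / 2) :
    M * cos Y + T ^ 2 * (M * (1 - cos Y) - 1.08 * S ^ 2 * (1 - cos Y)) ≤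
      M * (2 * T * sin Y * sin E + (1 + T ^ 2) * cos Y * cos E) := by
  have hp := pi_pos
  have hpi : π < 3.1416 := pi_lt_d4
  have hC0 : 0 ≤ cos Y := cos_nonneg_of_neg_pi_div_two_le_of_le (by linarith) hY
  have hC1 := cos_le_one Y
  have hs0 : 0 ≤ sin Y := sin_nonneg_of_nonneg_of_le_pi hY0 (by linarith)
  have hYC := mul_cos_le_sin hY0 hY
  have hYs := two_div_pi_mul_le_sin hY0 hY
  have hEs := two_div_pi_mul_le_sin hE0 hE2
  have hEc : 1 - E ^ 2 / 2 ≤ cos E := one_sub_sq_div_two_le_cos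
  have hEc0 : 0 ≤ cos E := cos_nonneg_of_neg_pi_div_two_le_of_le (by linarith) hE2
  have hq := half_sq_le_one_sub_cos hY0 hY
  -- The right side is the coefficient of `M T²` produced by `sin E ≥ 2E/π` and `cos E ≥ 1 - E²/2`.
  have hw : 1 - cos Y ≤ 4 / π * Y * sin Y - Y ^ 2 * cos Y / 2 := by
    have a1 : 1 - cos Y ≤ Y * sin Y / √2 := by
      have h1 := sin_two_mul (Y / 2)
      have h2 := cos_two_mul (Y / 2)
      rw [mul_div_cancel₀ Y two_ne_zero] at h1 h2
      have h3 : sin (Y / 2) ≤ Y / 2 := sin_le (by linarith)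
      have h4 : √2 / 2 ≤ cos (Y / 2) := by
        rw [← cos_pi_div_four]
        exact cos_le_cos_of_nonneg_of_le_pi (by linarith) (by linarith) (by linarith)
      have h5 : 0 ≤ sin (Y / 2) := sin_nonneg_of_nonneg_of_le_pi (by linarith) (by linarith)
      have h6 : 1 - cos Y = 2 * sin (Y / 2) ^ 2 := by rw [h2, cos_sq']; ring
      have h7 : sin (Y / 2) * √2 ≤ sin Y := by rw [h1]; nlinarith
      rw [le_div_iff₀ (by positivity), h6]
      calc 2 * sin (Y / 2) ^ 2 * √2 = (2 * sin (Y / 2)) * (sin (Y / 2) * √2) := by ring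
        _ ≤ Y * sin Y := by gcongr; linarith
    have a2 : Y ^ 2 * cos Y / 2 ≤ Y * sin Y / 2 := by nlinarith
    have a3 : 1.27 ≤ 4 / π := by rw [le_div_iff₀ hp]; linarith
    have a4 : 1 / √2 ≤ 0.77 := by
      rw [div_le_iff₀ (by positivity)]
      have : 1.4 ≤ √2 := by rw [Real.le_sqrt] <;> norm_num
      linarith
    have a5 : 0 ≤ Y * sin Y := by positivity
    have a6 : Y * sin Y / √2 ≤ 0.77 * (Y * sin Y) := by
      calc Y * sin Y / √2 = 1 / √2 * (Y * sin Y) := by ring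
        _ ≤ _ := by gcongr
    have a7 : 1.27 * (Y * sin Y) ≤ 4 / π * (Y * sin Y) := by gcongr
    linarith
  -- The corresponding terms with `S² T²`; `1.08` rounds up `π³/16 - (4 - π)`.
  have hj : π * Y ^ 2 / 4 - (4 - π) * sin Y ≤ 1.08 * (1 - cos Y) := by
    have h1 : 1 - cos Y ≤ sin Y := by nlinarith [sin_sq_add_cos_sq Y, sin_le_one Y]
    have h2 : Y ^ 2 ≤ (1 - cos Y) * π ^ 2 / 4 := by
      rw [div_le_iff₀ (by positivity)] at hq; linarith
    have h3 : π * Y ^ 2 / 4 ≤ π * ((1 - cos Y) * π ^ 2 / 4) / 4 := by gcongr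
    have h4 : (4 - π) * (1 - cos Y) ≤ (4 - π) * sin Y :=
      mul_le_mul_of_nonneg_left h1 (by linarith)
    have h5 : π ^ 3 / 16 - (4 - π) ≤ 1.08 := by
      have : π ^ 3 ≤ 3.1416 ^ 3 := by gcongr
      norm_num at this; linarith
    nlinarith
  -- the defect caused by replacing `cos E` by its Taylor polynomial
  have hEM : M * E ^ 2 * cos Y ≤ T ^ 2 * (M * Y ^ 2 * cos Y + 2 * π * S ^ 2 * sin Y
      + π * S ^ 2 * Y ^ 2 / 2) := by
    have e0 : M * (M * E ^ 2 * cos Y) = T ^ 2 * (M ^ 2 * Y ^ 2 * cos Y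
        + 2 * (π * S ^ 2) * M * (Y * cos Y) + π * S ^ 2 * (cos Y * π * S ^ 2)) := by
      calc M * (M * E ^ 2 * cos Y) = (E * M) ^ 2 * cos Y := by ring
        _ = _ := by rw [hE]; ring
    have e1 : cos Y * π * S ^ 2 ≤ M * Y ^ 2 / 2 := by nlinarith [sq_nonneg Y]
    have e2 : M * (M * E ^ 2 * cos Y) ≤ T ^ 2 * (M ^ 2 * Y ^ 2 * cos Y
        + 2 * (π * S ^ 2) * M * sin Y + π * S ^ 2 * (M * Y ^ 2 / 2)) := by
      rw [e0]; gcongr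
    refine le_of_mul_le_mul_left (e2.trans_eq ?_) hM0
    ring
  have hsin : M * (2 * T * sin Y * sin E) ≥ T ^ 2 * (M * (4 / π * Y * sin Y)
      + 4 * S ^ 2 * sin Y) := by
    have e1 : 2 * E / π ≤ sin E := by rw [div_le_iff₀ hp]; linarith
    calc T ^ 2 * (M * (4 / π * Y * sin Y) + 4 * S ^ 2 * sin Y)
        = 2 * T * sin Y * (2 * (T * (Y * M + π * S ^ 2)) / π) := by field_simp; ring
      _ = 2 * T * sin Y * (M * (2 * E / π)) := by rw [← hE]; ring
      _ ≤ 2 * T * sin Y * (M * sin E) := by gcongr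
      _ = _ := by ring
  have k5 : M * (cos Y * (1 - E ^ 2 / 2)) ≤ M * (cos Y * cos E) := by gcongr
  have k6 : 0 ≤ M * (T ^ 2 * (cos Y * cos E)) := by positivity
  have k7 : T ^ 2 * (M * (1 - cos Y)) ≤
      T ^ 2 * (M * (4 / π * Y * sin Y - Y ^ 2 * cos Y / 2)) := by gcongr
  have k8 : T ^ 2 * (S ^ 2 * (π * Y ^ 2 / 4 - (4 - π) * sin Y)) ≤
      T ^ 2 * (S ^ 2 * (1.08 * (1 - cos Y))) := by gcongr
  linarith

/-! ### Nonnegativity of the energy excess -/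

section Core

variable {S T c k Y D E : ℝ}

/-- The quantity that controls the excess of the energy over that of the square. -/
def energyExcess (S T c k Y D E : ℝ) : ℝ :=
  -(c * k) * (S ^ 2 + T ^ 2) - 2 * S ^ 2 * T ^ 2 +
    (c + k) * (k * (2 * S * sin Y * sin D - (1 + S ^ 2) * cos Y * cos D)
      + c * (2 * T * sin Y * sin E + (1 + T ^ 2) * cos Y * cos E))

/-- Since `ST + ck ≤ 1`, `S + T ≤ 2 - 2ST`; with `4ST ≤ (S + T)²` this yields `ST ≤ (3 - √5)/2 <
0.382`. -/
theorem mul_le_of_sum_le (hS : 0 ≤ S) (hT : 0 ≤ T)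
    (hSc : S ^ 2 + c ^ 2 = 1) (hTk : T ^ 2 + k ^ 2 = 1)
    (h : S + T + S * T ≤ 1 + c * k) : S * T ≤ 0.382 := by
  have h1 : S + T + 2 * (S * T) ≤ 2 := by nlinarith [sq_nonneg (S - T), sq_nonneg (c - k)]
  have h2 : (S + T) ^ 2 ≤ (2 - 2 * (S * T)) ^ 2 := by
    apply pow_le_pow_left₀ (by positivity); linarith
  by_contra! hn
  have : S * T ≤ 1 := by nlinarith [mul_nonneg hS hT]
  nlinarith [sq_nonneg (S - T)]

/-- From `D ≤ Y ≤ π/2 ≤ π - Y` the formula for `D` gives `S(M + 2T²) ≤ M` with `M = k(c + k) = 1 -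
T² + ck`, which is the hypothesis of `sum_le_one_add_mul_cos`. -/
theorem sum_le_of_weight_le (hS : 0 ≤ S) (hc : 0 < c) (hk : 0 < k)
    (hSc : S ^ 2 + c ^ 2 = 1) (hTk : T ^ 2 + k ^ 2 = 1) (hY : Y ≤ π / 2)
    (hD : D * (k * (c + k)) = S * ((π - Y) * (k * (c + k)) + π * T ^ 2)) (hDY : D ≤ Y) :
    S + T + S * T ≤ 1 + c * k := by
  have hp := pi_pos
  apply sum_le_one_add_mul_cos hS hc hk hSc hTk
  have hM : 0 < k * (c + k) := by positivity
  have h1 : D * (k * (c + k)) ≤ π / 2 * (k * (c + k)) := by gcongr; linarith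
  have h2 : S * (π / 2 * (k * (c + k))) ≤ S * ((π - Y) * (k * (c + k))) := by gcongr; linarith
  have h3 : π * (S * (k * (c + k) + 2 * T ^ 2)) ≤ π * (k * (c + k)) := by linarith
  have h4 := le_of_mul_le_mul_left h3 hp
  have h5 : T ^ 2 = 1 - k ^ 2 := by linarith
  rw [h5] at h4 ⊢
  linarith

/-- The criterion for the other pair, `T(M + 2S²) ≤ M` with `M = c(c + k)`, bounds `E` because `Y ≤
π/2`. This makes Jordan's inequality available for `E`. -/
theorem heavy_offset_le (hS : 0 ≤ S) (hT : 0 ≤ T) (hc : 0 < c) (hk : 0 < k)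
    (hSc : S ^ 2 + c ^ 2 = 1) (hTk : T ^ 2 + k ^ 2 = 1) (hY : Y ≤ π / 2)
    (hE : E * (c * (c + k)) = T * (Y * (c * (c + k)) + π * S ^ 2))
    (hN : S + T + S * T ≤ 1 + c * k) : E ≤ π / 2 := by
  have hp := pi_pos
  have hN1 := sq_mul_le_of_sum_le hT hS hk hc hTk hSc (by linarith)
  have hM0 : 0 < c * (c + k) := by positivity
  rw [← mul_le_mul_iff_left₀ hM0, hE]
  have h1 : T * (Y * (c * (c + k))) ≤ T * (π / 2 * (c * (c + k))) := by gcongr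
  have h2 : T * (c * (c + k) + 2 * S ^ 2) ≤ c * (c + k) := by
    have : c * (c + k) = 1 - S ^ 2 + c * k := by linarith
    rw [this]; linarith
  have h3 : π / 2 * (T * (c * (c + k) + 2 * S ^ 2)) ≤ π / 2 * (c * (c + k)) := by gcongr
  linarith

theorem energyExcess_nonneg_of_weight_le (hS : 0 ≤ S) (hT : 0 ≤ T) (hc : 0 < c) (hk : 0 < k)
    (hSc : S ^ 2 + c ^ 2 = 1) (hTk : T ^ 2 + k ^ 2 = 1) (hY0 : 0 ≤ Y) (hY : Y ≤ π / 2)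
    (hD : D * (k * (c + k)) = S * ((π - Y) * (k * (c + k)) + π * T ^ 2))
    (hE : E * (c * (c + k)) = T * (Y * (c * (c + k)) + π * S ^ 2)) (hDY : D ≤ Y) :
    0 ≤ energyExcess S T c k Y D E := by
  have hp := pi_pos
  have hck : 0 < c * k := by positivity
  have hSX : S * (π - Y) ≤ D := by
    have hM : 0 < k * (c + k) := by positivity
    rw [← mul_le_mul_iff_left₀ hM, hD]
    have : 0 ≤ S * (π * T ^ 2) := by positivity
    linarith
  have hN := sum_le_of_weight_le hS hc hk hSc hTk hY hD hDY
  have hST := mul_le_of_sum_le hS hT hSc hTk hN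
  have hE2 := heavy_offset_le hS hT hc hk hSc hTk hY hE hN
  obtain ⟨M, hM⟩ : ∃ M, M = c * (c + k) := ⟨_, rfl⟩
  have hM0 : 0 < M := by rw [hM]; positivity
  rw [← hM] at hE
  have hE0 : 0 ≤ E := by
    have : 0 ≤ E * M := by rw [hE]; positivity
    exact nonneg_of_mul_nonneg_left this hM0
  have hSY : S * (π - Y) ≤ Y := hSX.trans hDY
  have hlight := light_pair_bound hS hY0 hY hSX (hDY.trans hY)
  have hcs := cos_mul_sq_le hS hY hSY
  have hC0 : 0 ≤ cos Y := cos_nonneg_of_neg_pi_div_two_le_of_le (by linarith) hY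
  have hq := half_sq_le_one_sub_cos hY0 hY
  have hMc : c ^ 2 ≤ M := by rw [hM]; linarith
  have hl : k * (c + k) * (2 * S ^ 2 - cos Y) ≤ k * (c + k) *
      (2 * S * sin Y * sin D - (1 + S ^ 2) * cos Y * cos D) := by gcongr
  have hsplit : energyExcess S T c k Y D E = -(c * k) * (S ^ 2 + T ^ 2) - 2 * S ^ 2 * T ^ 2 +
      k * (c + k) * (2 * S * sin Y * sin D - (1 + S ^ 2) * cos Y * cos D) +
      M * (2 * T * sin Y * sin E + (1 + T ^ 2) * cos Y * cos E) := by
    rw [energyExcess, hM]; ring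
  have hcS : 1 - S ^ 2 = c ^ 2 := by linarith
  have hkT : k ^ 2 = 1 - T ^ 2 := by linarith
  rw [hcS] at hcs
  -- If `T ≤ S`, then `cos Y ≤ c² ≤ ck`, and the pair bounds leave `(S² - T²)(ck - cos Y) + 2S²(k² -
  -- T²)`. Otherwise the finer heavy bound and the polynomial inequality are needed.
  rcases le_total T S with hTS | hTS
  · have hck1 : c ≤ k := by
      apply le_of_sq_le_sq _ hk.le
      have := pow_le_pow_left₀ hT hTS 2
      linarith
    have hcosS : cos Y ≤ c ^ 2 := by
      have h1 : S * (π / 2) ≤ Y := le_trans (by gcongr; linarith) hSY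
      have h2 : S ^ 2 ≤ 4 * Y ^ 2 / π ^ 2 := by
        rw [le_div_iff₀ (by positivity)]
        have := pow_le_pow_left₀ (by positivity) h1 2
        linarith
      linarith
    have hcc : c ^ 2 ≤ c * k := by rw [sq]; gcongr
    have hheavy := heavy_pair_bound_of_le (c := c) hT hY0 hY hM0 (by rw [hM]; linarith) hcs hE
      hE0 hE2
    have hh : M * cos Y ≤ M * (2 * T * sin Y * sin E + (1 + T ^ 2) * cos Y * cos E) := by gcongr
    have hT2 : T ^ 2 ≤ 0.382 := by
      have := mul_le_mul_of_nonneg_right hTS hT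
      linarith
    have e1 : 0 ≤ S ^ 2 * (2 * k ^ 2 - 2 * T ^ 2) :=
      mul_nonneg (sq_nonneg S) (by linarith)
    have e2 : 0 ≤ (S ^ 2 - T ^ 2) * (c * k - cos Y) := by
      have := pow_le_pow_left₀ hT hTS 2
      exact mul_nonneg (by linarith) (by linarith)
    have e3 : M * cos Y - k * (c + k) * cos Y = (T ^ 2 - S ^ 2) * cos Y := by
      rw [hM]
      linear_combination (hSc - hTk) * cos Y
    rw [hsplit]
    linarith
  · have hck1 : k ≤ c := by
      apply le_of_sq_le_sq _ hc.le
      have := pow_le_pow_left₀ hS hTS 2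
      linarith
    have hheavy := heavy_pair_bound hT hY0 hY hM0 hMc hcs hE hE0 hE2
    have hS2 : S ≤ 0.6181 := by
      refine le_of_sq_le_sq ?_ (by norm_num)
      have := mul_le_mul_of_nonneg_left hTS hS
      norm_num
      linarith
    have hkk : k * k ≤ c * k := mul_le_mul_of_nonneg_right hck1 hk.le
    -- Here `πS ≤ Y(1 + S)` and `4 / 1.6181² > 1.5`.
    have hqS : 1.5 * S ^ 2 ≤ 1 - cos Y := by
      have h1 : π * S ≤ Y * (1 + S) := by linarith
      have h2 : (π * S) ^ 2 ≤ (Y * (1 + S)) ^ 2 := pow_le_pow_left₀ (by positivity) h1 2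
      have h3 : (1 + S) ^ 2 ≤ 1.6181 ^ 2 := by gcongr; linarith
      have h4 : 1.5 * S ^ 2 ≤ 4 * Y ^ 2 / π ^ 2 := by
        rw [le_div_iff₀ (by positivity)]
        have : Y ^ 2 * (1 + S) ^ 2 ≤ Y ^ 2 * 1.6181 ^ 2 := by gcongr
        norm_num at this
        have := sq_nonneg Y
        linarith
      linarith
    have hab : S ^ 2 * T ^ 2 ≤ 0.146 := by
      have : (S * T) ^ 2 ≤ 0.382 ^ 2 := by gcongr
      norm_num at this ⊢
      linarith
    have hpoly := golden_polynomial_bound (g := c * k) (m := M) (sq_nonneg S)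
      (pow_le_pow_left₀ hS hTS 2) (by have := sq_nonneg k; linarith) hab (by linarith)
      (by have := sq_nonneg (c - k); linarith) (le_refl (1 - cos Y)) hqS (by linarith)
      (by rw [hM]; linarith)
    have e3 : M * cos Y - k * (c + k) * cos Y = (T ^ 2 - S ^ 2) * cos Y := by
      rw [hM]
      linear_combination (hSc - hTk) * cos Y
    rw [hsplit]
    have e4 : k * (c + k) * (2 * S ^ 2) = S ^ 2 * (2 * (1 - T ^ 2) + 2 * (c * k)) := by
      rw [← hkT]; ring
    linarith

/-- Exchanging the two pairs of opposite vertices; this allows the assumption `Y ≤ π/2`. -/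
theorem energyExcess_swap : energyExcess S T c k Y D E = energyExcess T S k c (π - Y) E D := by
  simp only [energyExcess, sin_pi_sub, cos_pi_sub]
  ring

theorem energyExcess_nonneg (hS : 0 ≤ S) (hT : 0 ≤ T) (hc : 0 < c) (hk : 0 < k)
    (hSc : S ^ 2 + c ^ 2 = 1) (hTk : T ^ 2 + k ^ 2 = 1) (hY0 : 0 ≤ Y) (hYpi : Y ≤ π)
    (hD : D * (k * (c + k)) = S * ((π - Y) * (k * (c + k)) + π * T ^ 2))
    (hE : E * (c * (c + k)) = T * (Y * (c * (c + k)) + π * S ^ 2)) (hDY : D ≤ Y)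
    (hEY : E ≤ π - Y) : 0 ≤ energyExcess S T c k Y D E := by
  rcases le_total Y (π / 2) with hY | hY
  · exact energyExcess_nonneg_of_weight_le hS hT hc hk hSc hTk hY0 hY hD hE hDY
  · rw [energyExcess_swap]
    refine energyExcess_nonneg_of_weight_le hT hS hk hc hTk hSc (by linarith) (by linarith)
      ?_ ?_ hEY
    · rw [add_comm k c, sub_sub_cancel]; exact hE
    · rw [add_comm k c]; exact hD

/-- The same inequality without a sign condition on the eccentricities. -/
theorem energyExcess_nonneg' (hc : 0 < c) (hk : 0 < k)
    (hSc : S ^ 2 + c ^ 2 = 1) (hTk : T ^ 2 + k ^ 2 = 1) (hY0 : 0 ≤ Y) (hYpi : Y ≤ π)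
    (hD : D * (k * (c + k)) = S * ((π - Y) * (k * (c + k)) + π * T ^ 2))
    (hE : E * (c * (c + k)) = T * (Y * (c * (c + k)) + π * S ^ 2)) (hDY : |D| ≤ Y)
    (hEY : |E| ≤ π - Y) : 0 ≤ energyExcess S T c k Y D E := by
  have hp := pi_pos
  have hX : 0 ≤ π - Y := by linarith
  have hMk : 0 < k * (c + k) := by positivity
  have hMc : 0 < c * (c + k) := by positivity
  -- `D` has the sign of `S` and `E` that of `T`, so absolute values change nothing.
  have aux : ∀ x y m N : ℝ, 0 < m → 0 ≤ N → x * m = y * N →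
      |x| * m = |y| * N ∧ |y| * sin |x| = y * sin x := by
    intro x y m N hm hN h
    refine ⟨by rw [← abs_of_pos hm, ← abs_mul, h, abs_mul, abs_of_nonneg hN], ?_⟩
    rcases le_total 0 y with hy | hy
    · have hx : 0 ≤ x := nonneg_of_mul_nonneg_left (h ▸ mul_nonneg hy hN) hm
      rw [abs_of_nonneg hy, abs_of_nonneg hx]
    · have hx : x ≤ 0 := by
        have : x * m ≤ 0 := h ▸ mul_nonpos_of_nonpos_of_nonneg hy hN
        exact nonpos_of_mul_nonpos_left this hm
      rw [abs_of_nonpos hy, abs_of_nonpos hx, sin_neg]; ring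
  obtain ⟨d1, d2⟩ := aux D S _ _ hMk (by positivity) hD
  obtain ⟨e1, e2⟩ := aux E T _ _ hMc (by positivity) hE
  have key := energyExcess_nonneg (abs_nonneg S) (abs_nonneg T) hc hk (by rwa [sq_abs])
    (by rwa [sq_abs]) hY0 hYpi (by rwa [sq_abs]) (by rwa [sq_abs]) hDY hEY
  have : energyExcess |S| |T| c k Y |D| |E| = energyExcess S T c k Y D E := by
    simp only [energyExcess, sq_abs, cos_abs]
    linear_combination (c + k) * k * 2 * sin Y * d2 + (c + k) * c * 2 * sin Y * e2
  rwa [this] at key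

end Core

/-! ### Harmonic measure of arcs and its derivative -/

theorem norm_circleMap_zero_one (θ : ℝ) : ‖circleMap 0 1 θ‖ = 1 := by simp

theorem circleMap_mul_conj (θ : ℝ) : circleMap 0 1 θ * conj (circleMap 0 1 θ) = 1 := by
  rw [Complex.mul_conj, Complex.normSq_eq_norm_sq, norm_circleMap_zero_one]; simp

theorem circleMap_sub_ne_zero {z : ℂ} (hz : ‖z‖ < 1) (θ : ℝ) : circleMap 0 1 θ - z ≠ 0 := by
  intro h
  have : ‖circleMap 0 1 θ‖ = ‖z‖ := by rw [sub_eq_zero.1 h]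
  rw [norm_circleMap_zero_one] at this
  linarith

theorem one_sub_norm_le_norm_circleMap_sub (z : ℂ) (θ : ℝ) :
    1 - ‖z‖ ≤ ‖circleMap 0 1 θ - z‖ := by
  have := norm_sub_norm_le (circleMap 0 1 θ) z
  rwa [norm_circleMap_zero_one] at this

theorem continuous_herglotz {z : ℂ} (hz : ‖z‖ < 1) :
    Continuous fun θ => (circleMap 0 1 θ + z) / (circleMap 0 1 θ - z) := by
  apply Continuous.div (by fun_prop) (by fun_prop)
  exact circleMap_sub_ne_zero hz

theorem continuous_poissonKernel_circleMap {z : ℂ} (hz : ‖z‖ < 1) :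
    Continuous fun θ => poissonKernel 0 z (circleMap 0 1 θ) := by
  rw [poissonKernel_eq_re_herglotzRieszKernel]
  simp only [Function.comp_apply, herglotzRieszKernel, sub_zero]
  exact Complex.continuous_re.comp (continuous_herglotz hz)

theorem poissonKernel_circleMap_nonneg {z : ℂ} (hz : ‖z‖ < 1) (θ : ℝ) :
    0 ≤ poissonKernel 0 z (circleMap 0 1 θ) := by
  rw [poissonKernel]
  simp only [sub_zero, norm_circleMap_zero_one]
  apply div_nonneg _ (sq_nonneg _)
  nlinarith [norm_nonneg z]

theorem harmonicMeasure_eq_re (a b : ℝ) {z : ℂ} (hz : ‖z‖ < 1) :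
    harmonicMeasure a b z = (2 * π)⁻¹ *
      (∫ θ in a..b, (circleMap 0 1 θ + z) / (circleMap 0 1 θ - z)).re := by
  rw [harmonicMeasure, ← Complex.reCLM_apply, ← ContinuousLinearMap.intervalIntegral_comp_comm]
  · simp only [poissonKernel_eq_re_herglotzRieszKernel, Function.comp_apply, herglotzRieszKernel,
      sub_zero, Complex.reCLM_apply]
  · exact (continuous_herglotz hz).intervalIntegrable _ _

theorem harmonicMeasure_nonneg {a b : ℝ} (hab : a ≤ b) {z : ℂ} (hz : ‖z‖ < 1) :
    0 ≤ harmonicMeasure a b z :=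
  mul_nonneg (by positivity)
    (intervalIntegral.integral_nonneg hab fun θ _ => poissonKernel_circleMap_nonneg hz θ)

theorem harmonicMeasure_add (a b c : ℝ) {z : ℂ} (hz : ‖z‖ < 1) :
    harmonicMeasure a b z + harmonicMeasure b c z = harmonicMeasure a c z := by
  rw [harmonicMeasure, harmonicMeasure, harmonicMeasure, ← mul_add,
    intervalIntegral.integral_add_adjacent_intervals] <;>
  exact (continuous_poissonKernel_circleMap hz).intervalIntegrable _ _

theorem harmonicMeasure_full {z : ℂ} (hz : ‖z‖ < 1) : harmonicMeasure 0 (2 * π) z = 1 := by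
  have h := DiffContOnCl.circleAverage_poissonKernel_smul (f := fun _ => (1 : ℂ)) (c := 0)
    (R := 1) (w := z) diffContOnCl_const (by simpa using hz)
  have h2 := congrArg Complex.re h
  rw [Real.circleAverage_def] at h2
  simp only [Pi.smul_apply', Complex.real_smul, mul_one, Complex.one_re] at h2
  rw [intervalIntegral.integral_ofReal, Complex.re_ofReal_mul, Complex.ofReal_re] at h2
  exact h2

/-- The complex derivative of the analytic completion of `harmonicMeasure a b`. -/
def harmonicMeasureDeriv (a b : ℝ) (z : ℂ) : ℂ :=
  Complex.I / π * (1 / (circleMap 0 1 b - z) - 1 / (circleMap 0 1 a - z))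

theorem integral_herglotz_deriv (a b : ℝ) {z : ℂ} (hz : ‖z‖ < 1) :
    ∫ θ in a..b, 2 * circleMap 0 1 θ / (circleMap 0 1 θ - z) ^ 2 =
      2 * Complex.I * (1 / (circleMap 0 1 b - z) - 1 / (circleMap 0 1 a - z)) := by
  rw [mul_sub]
  refine intervalIntegral.integral_eq_sub_of_hasDerivAt
    (f := fun θ => 2 * Complex.I * (1 / (circleMap 0 1 θ - z))) (fun θ _ => ?_) ?_
  · have h1 : HasDerivAt (fun t => (circleMap 0 1 t - z)⁻¹) _ θ :=
      ((hasDerivAt_circleMap 0 1 θ).sub_const z).inv (circleMap_sub_ne_zero hz θ)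
    have h2 := h1.const_mul (2 * Complex.I : ℂ)
    simp only [one_div]
    refine h2.congr_deriv ?_
    rw [mul_div_assoc', neg_mul_eq_mul_neg]
    congr 1
    linear_combination (-2 * circleMap 0 1 θ) * Complex.I_sq
  · apply Continuous.intervalIntegrable
    apply Continuous.div (by fun_prop) (by fun_prop)
    exact fun θ => pow_ne_zero 2 (circleMap_sub_ne_zero hz θ)

theorem hasDerivAt_integral_herglotz (a b : ℝ) {z : ℂ} (hz : ‖z‖ < 1) :
    HasDerivAt (fun w => ∫ θ in a..b, (circleMap 0 1 θ + w) / (circleMap 0 1 θ - w))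
      (2 * Complex.I * (1 / (circleMap 0 1 b - z) - 1 / (circleMap 0 1 a - z))) z := by
  rw [← integral_herglotz_deriv a b hz]
  -- On a smaller disk the derivative of the kernel is bounded by `2 / (1 - r)²`.
  obtain ⟨r, hr, hr1⟩ := exists_between hz
  have hs : Metric.ball (0 : ℂ) r ∈ nhds z :=
    Metric.isOpen_ball.mem_nhds (by simpa using hr)
  have hball : ∀ w ∈ Metric.ball (0 : ℂ) r, ‖w‖ < 1 := fun w hw =>
    lt_trans (by simpa using hw) hr1
  refine (intervalIntegral.hasDerivAt_integral_of_dominated_loc_of_deriv_le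
    (F := fun w θ => (circleMap 0 1 θ + w) / (circleMap 0 1 θ - w))
    (F' := fun w θ => 2 * circleMap 0 1 θ / (circleMap 0 1 θ - w) ^ 2)
    (bound := fun _ => 2 / (1 - r) ^ 2) hs ?_ ?_ ?_ ?_ ?_ ?_).2
  · filter_upwards [hs] with w hw
    exact (continuous_herglotz (hball w hw)).aestronglyMeasurable
  · exact (continuous_herglotz hz).intervalIntegrable _ _
  · apply Continuous.aestronglyMeasurable
    apply Continuous.div (by fun_prop) (by fun_prop)
    exact fun θ => pow_ne_zero 2 (circleMap_sub_ne_zero hz θ)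
  · refine Filter.Eventually.of_forall fun θ _ w hw => ?_
    rw [norm_div, norm_mul, norm_circleMap_zero_one, norm_pow, mul_one, Complex.norm_ofNat]
    have h1 : 1 - r ≤ ‖circleMap 0 1 θ - w‖ := by
      have := one_sub_norm_le_norm_circleMap_sub w θ
      have : ‖w‖ < r := by simpa using hw
      linarith
    have : 0 < 1 - r := by linarith
    gcongr
  · exact intervalIntegrable_const
  · refine Filter.Eventually.of_forall fun θ _ w hw => ?_
    have hne := circleMap_sub_ne_zero (hball w hw) θ
    have h1 := ((hasDerivAt_id w).const_add (circleMap 0 1 θ)).div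
      ((hasDerivAt_id w).const_sub (circleMap 0 1 θ)) hne
    refine h1.congr_deriv ?_
    simp only [id]
    congr 1
    ring

/-- The real-linear map `v ↦ p v + r v̄` of the plane. -/
def realLinear (p r : ℂ) : ℂ →L[ℝ] ℂ :=
  p • ContinuousLinearMap.id ℝ ℂ + r • (Complex.conjCLE : ℂ →L[ℝ] ℂ)

@[simp] theorem realLinear_apply (p r v : ℂ) : realLinear p r v = p * v + r * conj v := by
  simp [realLinear]

/-- The real part of a holomorphic function with derivative `g` has the differential `v ↦ Re (g v)`.
-/
theorem hasFDerivAt_harmonicMeasure (a b : ℝ) {z : ℂ} (hz : ‖z‖ < 1) :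
    HasFDerivAt (fun w => (harmonicMeasure a b w : ℂ))
      (realLinear (harmonicMeasureDeriv a b z / 2) (conj (harmonicMeasureDeriv a b z) / 2)) z := by
  have h1 := (hasDerivAt_integral_herglotz a b hz).hasFDerivAt.restrictScalars ℝ
  have h2 := (Complex.ofRealCLM.comp Complex.reCLM).hasFDerivAt.comp z h1
  have h3 := h2.const_mul ((2 * π)⁻¹ : ℂ)
  have hev : (fun w => (harmonicMeasure a b w : ℂ)) =ᶠ[nhds z] fun w => ((2 * π)⁻¹ : ℂ) *
      ((Complex.ofRealCLM.comp Complex.reCLM) ∘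
        fun w => ∫ θ in a..b, (circleMap 0 1 θ + w) / (circleMap 0 1 θ - w)) w := by
    filter_upwards [Metric.isOpen_ball.mem_nhds (show z ∈ Metric.ball (0 : ℂ) 1 by simpa using hz)]
      with w hw
    rw [harmonicMeasure_eq_re a b (by simpa using hw)]
    simp
  refine (h3.congr_of_eventuallyEq hev).congr_fderiv ?_
  ext v
  simp only [_root_.smul_apply, ContinuousLinearMap.comp_apply,
    realLinear_apply, smul_eq_mul]
  simp only [ContinuousLinearMap.coe_restrictScalars', Complex.reCLM_apply,
    Complex.ofRealCLM_apply]
  rw [Complex.re_eq_add_conj, harmonicMeasureDeriv]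
  have h2' : conj (2 : ℂ) = 2 := Complex.conj_ofNat 2
  simp [h2']
  field_simp

/-! ### Harmonic measure as an angle -/

/-- The disk automorphism that sends `z` to the center, applied to the point `e^{iθ}`. -/
def centered (z : ℂ) (θ : ℝ) : ℂ :=
  (circleMap 0 1 θ - z) / (1 - conj z * circleMap 0 1 θ)

theorem one_sub_conj_mul_circleMap (z : ℂ) (θ : ℝ) :
    1 - conj z * circleMap 0 1 θ = circleMap 0 1 θ * conj (circleMap 0 1 θ - z) := by
  rw [map_sub, mul_sub, circleMap_mul_conj]; ring

theorem one_sub_conj_mul_circleMap_ne_zero {z : ℂ} (hz : ‖z‖ < 1) (θ : ℝ) :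
    1 - conj z * circleMap 0 1 θ ≠ 0 := by
  rw [one_sub_conj_mul_circleMap]
  exact mul_ne_zero (circleMap_ne_center one_ne_zero)
    ((map_ne_zero _).2 (circleMap_sub_ne_zero hz θ))

theorem norm_centered {z : ℂ} (hz : ‖z‖ < 1) (θ : ℝ) : ‖centered z θ‖ = 1 := by
  rw [centered, one_sub_conj_mul_circleMap, norm_div, norm_mul, RCLike.norm_conj,
    norm_circleMap_zero_one, one_mul, div_self]
  exact norm_ne_zero_iff.2 (circleMap_sub_ne_zero hz θ)

theorem centered_mul_conj {z : ℂ} (hz : ‖z‖ < 1) (θ : ℝ) :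
    centered z θ * conj (centered z θ) = 1 := by
  rw [Complex.mul_conj, Complex.normSq_eq_norm_sq, norm_centered hz]; simp

theorem conj_centered {z : ℂ} (hz : ‖z‖ < 1) (θ : ℝ) :
    conj (centered z θ) = (1 - conj z * circleMap 0 1 θ) / (circleMap 0 1 θ - z) := by
  have h := centered_mul_conj hz θ
  have h1 := circleMap_sub_ne_zero hz θ
  have h2 := one_sub_conj_mul_circleMap_ne_zero hz θ
  rw [centered, div_mul_eq_mul_div, div_eq_one_iff_eq h2] at h
  rw [eq_div_iff h1, centered, mul_comm]
  exact h

/-- The Poisson kernel is the angular speed of the automorphism on the boundary circle. -/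
theorem hasDerivAt_centered {z : ℂ} (hz : ‖z‖ < 1) (θ : ℝ) :
    HasDerivAt (centered z)
      (centered z θ * (Complex.I * poissonKernel 0 z (circleMap 0 1 θ))) θ := by
  have h1 := circleMap_sub_ne_zero hz θ
  have h2 := one_sub_conj_mul_circleMap_ne_zero hz θ
  have hd := ((hasDerivAt_circleMap 0 1 θ).sub_const z).div
    (((hasDerivAt_circleMap 0 1 θ).const_mul (conj z)).const_sub 1) h2
  refine hd.congr_deriv ?_
  have hP : (poissonKernel 0 z (circleMap 0 1 θ) : ℂ) = circleMap 0 1 θ * (1 - conj z * z) /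
      ((circleMap 0 1 θ - z) * (1 - conj z * circleMap 0 1 θ)) := by
    rw [poissonKernel]
    simp only [sub_zero, norm_circleMap_zero_one]
    rw [one_sub_conj_mul_circleMap]
    have h3 : (circleMap 0 1 θ) ≠ 0 := circleMap_ne_center one_ne_zero
    have h4 : conj (circleMap 0 1 θ - z) ≠ 0 := (map_ne_zero _).2 h1
    push_cast
    rw [← Complex.conj_mul' z, ← Complex.mul_conj' (circleMap 0 1 θ - z)]
    field_simp
  rw [hP, centered]
  field_simp
  ring

/-- Conformal invariance: `2π` times the harmonic measure is the angle swept out by the image of the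
arc. -/
theorem centered_eq_mul_exp {z : ℂ} (hz : ‖z‖ < 1) (a b : ℝ) :
    centered z b = centered z a * Complex.exp (2 * π * harmonicMeasure a b z * Complex.I) := by
  have hcont := continuous_poissonKernel_circleMap hz
  obtain ⟨F, hF⟩ : ∃ F : ℝ → ℝ, F = fun t => ∫ θ in a..t, poissonKernel 0 z (circleMap 0 1 θ) :=
    ⟨_, rfl⟩
  have hFd : ∀ t, HasDerivAt F (poissonKernel 0 z (circleMap 0 1 t)) t := fun t => by
    rw [hF]
    exact intervalIntegral.integral_hasDerivAt_right (hcont.intervalIntegrable _ _)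
      (hcont.stronglyMeasurableAtFilter _ _) hcont.continuousAt
  have hGd : ∀ t, HasDerivAt (fun t => centered z t * Complex.exp (-(F t * Complex.I))) 0 t := by
    intro t
    have h1 := (((hFd t).ofReal_comp.mul_const Complex.I).neg).cexp
    refine ((hasDerivAt_centered hz t).mul h1).congr_deriv ?_
    ring
  have hconst := is_const_of_deriv_eq_zero (fun t => (hGd t).differentiableAt)
    (fun t => (hGd t).deriv) b a
  have hFa : F a = 0 := by simp [hF]
  have hFb : (F b : ℂ) = 2 * π * harmonicMeasure a b z := by
    rw [harmonicMeasure, hF]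
    push_cast
    have : (π : ℂ) ≠ 0 := by exact_mod_cast pi_ne_zero
    field_simp
  simp only [hFa, hFb, Complex.ofReal_zero, zero_mul, neg_zero, Complex.exp_zero, mul_one]
    at hconst
  rw [← hconst, mul_assoc, ← Complex.exp_add, neg_add_cancel, Complex.exp_zero, mul_one]

/-! ### The parameters in algebraic form -/

section Parameters

variable {p q : ℝ}

theorem arcParam_pos (hp : 0 < p) (hpq : p < q) (hq : q ≤ π) : 0 < arcParam p q := by
  rw [arcParam]
  have h1 : 0 < sin p := sin_pos_of_pos_of_lt_pi hp (by linarith)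
  have h2 : 0 < sin (q - p) := sin_pos_of_pos_of_lt_pi (by linarith) (by linarith)
  have : 0 < arctan √(sin p / sin (q - p)) := arctan_pos.2 (by positivity)
  linarith

theorem arcParam_lt_pi (p q : ℝ) : arcParam p q < π := by
  rw [arcParam]
  linarith [arctan_lt_pi_div_two √(sin p / sin (q - p))]

theorem cos_arcParam (hp : 0 < p) (hpq : p < q) (hq : q ≤ π) :
    cos (arcParam p q) * (sin (q - p) + sin p) = sin (q - p) - sin p := by
  have h1 : 0 < sin p := sin_pos_of_pos_of_lt_pi hp (by linarith)
  have h2 : 0 < sin (q - p) := sin_pos_of_pos_of_lt_pi (by linarith) (by linarith)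
  have h3 : √(sin p / sin (q - p)) ^ 2 = sin p / sin (q - p) := sq_sqrt (by positivity)
  rw [arcParam, cos_two_mul, cos_sq_arctan, h3]
  field_simp
  ring

theorem sin_sq_half_add_cos_sq (p q : ℝ) :
    sin (q / 2) ^ 2 + cos (p - q / 2) ^ 2 = 1 + sin (q - p) * sin p := by
  rw [show q - p = q / 2 - (p - q / 2) by ring, show sin p = sin (q / 2 + (p - q / 2)) by ring_nf,
    sin_sub, sin_add]
  linear_combination sin (p - q / 2) ^ 2 * sin_sq_add_cos_sq (q / 2)
    + (1 - sin (q / 2) ^ 2) * sin_sq_add_cos_sq (p - q / 2)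

theorem cos_betaParam (hp : 0 < p) (hpq : p < q) (hq : q ≤ π) :
    cos (2 * betaParam p q) * (1 + sin (q - p) * sin p) = cos (q - p) * cos p := by
  have h1 : 0 < cos (p - q / 2) := cos_pos_of_mem_Ioo ⟨by linarith, by linarith⟩
  have e2 : cos (p - q / 2) ^ 2 - sin (q / 2) ^ 2 = cos (q - p) * cos p := by
    rw [show q - p = q / 2 - (p - q / 2) by ring,
      show cos p = cos (q / 2 + (p - q / 2)) by ring_nf, cos_sub (q / 2) (p - q / 2),
      cos_add (q / 2) (p - q / 2)]
    linear_combination -cos (p - q / 2) ^ 2 * sin_sq_add_cos_sq (q / 2)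
      + sin (q / 2) ^ 2 * sin_sq_add_cos_sq (p - q / 2)
  rw [betaParam, cos_two_mul, cos_sq_arctan, ← sin_sq_half_add_cos_sq, ← e2]
  have h2 := h1.ne'
  have h3 : cos (p - q / 2) ^ 2 + sin (q / 2) ^ 2 ≠ 0 := by positivity
  rw [div_pow, one_add_div (pow_ne_zero 2 h2), one_div_div, add_comm (sin (q / 2) ^ 2)]
  generalize cos (p - q / 2) = w at *
  generalize sin (q / 2) = x at *
  field_simp
  ring

theorem sin_betaParam (hp : 0 < p) (hpq : p < q) (hq : q ≤ π) :
    sin (2 * betaParam p q) * (1 + sin (q - p) * sin p) = sin (q - p) + sin p := by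
  have h1 : 0 < cos (p - q / 2) := cos_pos_of_mem_Ioo ⟨by linarith, by linarith⟩
  have e2 : 2 * sin (q / 2) * cos (p - q / 2) = sin (q - p) + sin p := by
    rw [show q - p = q / 2 - (p - q / 2) by ring,
      show sin p = sin (q / 2 + (p - q / 2)) by ring_nf, sin_sub, sin_add]
    ring
  have h2 := h1.ne'
  have h3 : cos (p - q / 2) ^ 2 + sin (q / 2) ^ 2 ≠ 0 := by positivity
  have h4 : sin (2 * betaParam p q) = 2 * (sin (q / 2) / cos (p - q / 2)) /
      (1 + (sin (q / 2) / cos (p - q / 2)) ^ 2) := by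
    have hpos : 0 < 1 + (sin (q / 2) / cos (p - q / 2)) ^ 2 := by positivity
    rw [betaParam, sin_two_mul, sin_arctan, cos_arctan, mul_assoc, div_mul_div_comm,
      mul_self_sqrt hpos.le]
    ring
  rw [h4, ← sin_sq_half_add_cos_sq, ← e2, div_pow, one_add_div (pow_ne_zero 2 h2), div_div_eq_mul_div,
    add_comm (sin (q / 2) ^ 2)]
  generalize cos (p - q / 2) = w at *
  generalize sin (q / 2) = x at *
  field_simp

/-- The direction of the bisector of the vertices `P₁` and `P₃`. -/
def bisector (p q : ℝ) : ℂ := circleMap 0 1 (2 * betaParam p q)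

theorem circleMap_zero_one (θ : ℝ) : circleMap 0 1 θ = cos θ + sin θ * Complex.I := by
  rw [circleMap_zero, Complex.exp_mul_I]; push_cast; ring

theorem circleMap_zero_one_add (θ φ : ℝ) :
    circleMap 0 1 (θ + φ) = circleMap 0 1 θ * circleMap 0 1 φ := by
  simp only [circleMap_zero, Complex.ofReal_one, one_mul, Complex.ofReal_add, add_mul,
    Complex.exp_add]

theorem vertex₁_eq (p q : ℝ) :
    vertex₁ p q = bisector p q * (cos (q - p) + sin (q - p) * Complex.I) := by
  rw [vertex₁, circleMap_zero_one_add, mul_comm, circleMap_zero_one (q - p), bisector]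

theorem vertex₃_eq (p q : ℝ) :
    vertex₃ p q = bisector p q * (cos (q - p) - sin (q - p) * Complex.I) := by
  rw [vertex₃, circleMap_zero_one_add, mul_comm, circleMap_zero_one (p - q), bisector,
    ← neg_sub q p, cos_neg, sin_neg]
  push_cast; ring

theorem vertex₂_eq (p q : ℝ) : vertex₂ p q = cos p - sin p * Complex.I := by
  rw [vertex₂, circleMap_zero_one, cos_neg, sin_neg]; push_cast; ring

theorem vertex₄_eq (p q : ℝ) : vertex₄ p q = cos p + sin p * Complex.I := by
  rw [vertex₄, circleMap_zero_one]

end Parameters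

/-- The data of a bicentric quadrilateral in the unit circle with the vertices
`y (S + i c)`, `-T - i k`, `y (S - i c)`, `-T + i k`, together with the arc parameter `a`. -/
structure BicentricData (S T c k : ℝ) (y a : ℂ) : Prop where
  c_pos : 0 < c
  k_pos : 0 < k
  sq_add_sq : S ^ 2 + c ^ 2 = 1
  sq_add_sq' : T ^ 2 + k ^ 2 = 1
  norm_y : y.re ^ 2 + y.im ^ 2 = 1
  re_y : y.re * (1 + c * k) = -(S * T)
  im_y : y.im * (1 + c * k) = c + k
  norm_a : a.re ^ 2 + a.im ^ 2 = 1
  re_a : a.re * (c + k) = c - k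
  im_a : 0 < a.im

/-- With `T = -cos p`, the numbers `S` and `T` are the signed distances of the diagonals `P₁P₃` and
`P₂P₄` from the center, and `c`, `k` are their half lengths. -/
theorem bicentricData {p q : ℝ} (hp : 0 < p) (hpq : p < q) (hq : q ≤ π) :
    BicentricData (cos (q - p)) (-cos p) (sin (q - p)) (sin p) (bisector p q)
      (circleMap 0 1 (arcParam p q)) where
  c_pos := sin_pos_of_pos_of_lt_pi (by linarith) (by linarith)
  k_pos := sin_pos_of_pos_of_lt_pi hp (by linarith)
  sq_add_sq := by rw [add_comm]; exact sin_sq_add_cos_sq _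
  sq_add_sq' := by rw [neg_sq, add_comm]; exact sin_sq_add_cos_sq _
  norm_y := by
    rw [bisector, circleMap_zero_one]; simp [-Complex.ofReal_cos, -Complex.ofReal_sin]
  re_y := by
    rw [bisector, circleMap_zero_one]
    simp [cos_betaParam hp hpq hq, -Complex.ofReal_cos, -Complex.ofReal_sin]
  im_y := by
    rw [bisector, circleMap_zero_one]
    simp [sin_betaParam hp hpq hq, -Complex.ofReal_cos, -Complex.ofReal_sin]
  norm_a := by
    rw [circleMap_zero_one]; simp [-Complex.ofReal_cos, -Complex.ofReal_sin]
  re_a := by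
    rw [circleMap_zero_one]
    simp [cos_arcParam hp hpq hq, -Complex.ofReal_cos, -Complex.ofReal_sin]
  im_a := by
    rw [circleMap_zero_one]
    simp [-Complex.ofReal_cos, -Complex.ofReal_sin]
    exact sin_pos_of_pos_of_lt_pi (arcParam_pos hp hpq hq) (arcParam_lt_pi p q)

/-! ### Analytic parts of the projection -/

/-- The piecewise constant boundary values `y (S + i c)`, `-T - i k`, `y (S - i c)`, `-T + i k`
on the arcs between `1, a, -1, -a` have the harmonic extension with this `z`-derivative. -/
def analyticPart (a y S T c k z : ℂ) : ℂ :=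
  Complex.I / (2 * π) * (y * (S + c * Complex.I) * (1 / (a - z) - 1 / (1 - z))
    + (-T - k * Complex.I) * (1 / (-1 - z) - 1 / (a - z))
    + y * (S - c * Complex.I) * (1 / (-a - z) - 1 / (-1 - z))
    + (-T + k * Complex.I) * (1 / (1 - z) - 1 / (-a - z)))

def coeff₀ (a y c k : ℂ) : ℂ := a * (a * (c * y - k) - (c * y + k)) / π

def coeff₁ (a y S T : ℂ) : ℂ := -Complex.I * (a ^ 2 - 1) * (S * y + T) / π

def coeff₂ (a y c k : ℂ) : ℂ := (a * (c * y + k) - (c * y - k)) / π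

/-- No cubic term appears: the residues are proportional to differences of consecutive vertices,
which sum to zero. -/
theorem analyticPart_eq {a y S T c k z : ℂ} (h1 : 1 - z ≠ 0) (h2 : -1 - z ≠ 0) (h3 : a - z ≠ 0)
    (h4 : -a - z ≠ 0) : analyticPart a y S T c k z * ((z ^ 2 - 1) * (z ^ 2 - a ^ 2)) =
      coeff₀ a y c k + coeff₁ a y S T * z + coeff₂ a y c k * z ^ 2 := by
  have hpi : (π : ℂ) ≠ 0 := by exact_mod_cast pi_ne_zero
  rw [analyticPart, coeff₀, coeff₁, coeff₂]
  have e : (z ^ 2 - 1) * (z ^ 2 - a ^ 2) = (1 - z) * (-1 - z) * (a - z) * (-a - z) := by ring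
  rw [e]
  field_simp
  linear_combination (2 * y * c * (z ^ 2 - z ^ 2 * a + a - a ^ 2)
    - 2 * k * (z ^ 2 * a + z ^ 2 - a - a ^ 2)) * Complex.I_sq

section

variable {S T c k : ℝ} {y a : ℂ} (d : BicentricData S T c k y a)
include d

theorem BicentricData.y_mul_conj : y * conj y = 1 := by
  rw [Complex.mul_conj, Complex.normSq_apply]; norm_cast; linarith [d.norm_y]

theorem BicentricData.a_mul_conj : a * conj a = 1 := by
  rw [Complex.mul_conj, Complex.normSq_apply]; norm_cast; linarith [d.norm_a]

theorem BicentricData.y_add_conj : (y + conj y) * (1 + c * k) = -2 * (S * T) := by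
  rw [Complex.add_conj]
  have := congrArg (fun x : ℝ => (x : ℂ)) d.re_y
  push_cast at this ⊢
  linear_combination 2 * this

theorem BicentricData.y_sub_conj : (y - conj y) * (1 + c * k) = 2 * Complex.I * (c + k) := by
  rw [Complex.sub_conj]
  have := congrArg (fun x : ℝ => (x : ℂ)) d.im_y
  push_cast at this ⊢
  linear_combination 2 * Complex.I * this

theorem BicentricData.a_sq : (c + k) * (a ^ 2 + 1) = 2 * (c - k) * a := by
  have h1 := d.a_mul_conj
  have h2 := Complex.add_conj a
  have := congrArg (fun x : ℝ => (x : ℂ)) d.re_a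
  push_cast at this h2
  linear_combination -(c + k) * h1 + (c + k) * a * h2 + 2 * a * this

theorem BicentricData.sq_add_sq_complex : (S : ℂ) ^ 2 + (c : ℂ) ^ 2 = 1 := by
  exact_mod_cast d.sq_add_sq

theorem BicentricData.sq_add_sq_complex' : (T : ℂ) ^ 2 + (k : ℂ) ^ 2 = 1 := by
  exact_mod_cast d.sq_add_sq'

theorem BicentricData.c_add_k_ne_zero : (c : ℂ) + k ≠ 0 := by
  have := add_pos d.c_pos d.k_pos
  exact_mod_cast this.ne'

/-- The discriminant of the numerator vanishes: `a_sq` encodes the choice of the arcs, the other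
relations the bicentric position. The dilatation is a square for this reason. -/
theorem BicentricData.coeff₁_sq :
    coeff₁ a y S T ^ 2 = 4 * coeff₀ a y c k * coeff₂ a y c k := by
  have hpi : (π : ℂ) ≠ 0 := by exact_mod_cast pi_ne_zero
  have hck := d.c_add_k_ne_zero
  have key : ((c : ℂ) + k) ^ 2 * (4 * (a * (a * (c * y - k) - (c * y + k)) *
      (a * (c * y + k) - (c * y - k))) + ((a ^ 2 - 1) * (S * y + T)) ^ 2) = 0 := by
    linear_combination (4 * a * (c + k) * ((c * y) ^ 2 - k ^ 2) +
      ((c + k) * (a ^ 2 + 1) + 2 * (c - k) * a) * (S * y + T) ^ 2) * d.a_sq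
      - 16 * a ^ 2 * c * k * (y ^ 2 * d.sq_add_sq_complex + d.sq_add_sq_complex'
        + y * d.y_add_conj - (1 + c * k) * d.y_mul_conj)
  have key2 := (mul_eq_zero.1 key).resolve_left (pow_ne_zero 2 hck)
  rw [coeff₀, coeff₁, coeff₂]
  field_simp
  linear_combination (a ^ 2 - 1) ^ 2 * (S * y + T) ^ 2 * Complex.I_sq - key2

/-- Conjugating the boundary values reverses and conjugates the numerator, because `a ā = 1`. -/
theorem BicentricData.coeff_conj :
    coeff₀ a (conj y) (-c) (-k) = a ^ 2 * conj (coeff₂ a y c k) ∧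
    coeff₁ a (conj y) S T = a ^ 2 * conj (coeff₁ a y S T) ∧
    coeff₂ a (conj y) (-c) (-k) = a ^ 2 * conj (coeff₀ a y c k) := by
  have hpi : (π : ℂ) ≠ 0 := by exact_mod_cast pi_ne_zero
  have h := d.a_mul_conj
  refine ⟨?_, ?_, ?_⟩
  · simp only [coeff₀, coeff₂, map_div₀, map_mul, map_sub, map_add, Complex.conj_ofReal]
    field_simp
    linear_combination (-(a * (c * conj y + k))) * h
  · simp only [coeff₁, map_div₀, map_mul, map_sub, map_add, map_neg, map_pow, map_one,
      Complex.conj_ofReal, Complex.conj_I]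
    field_simp
    linear_combination (-(S * conj y + T)) * (a * conj a + 1) * h
  · simp only [coeff₀, coeff₂, map_div₀, map_mul, map_sub, map_add, Complex.conj_ofReal]
    field_simp
    linear_combination (-(a * conj a + 1) * (c * conj y - k) + a * (c * conj y + k)) * h

/-- The squared norms differ by `8 Im(a) c k Im(y) / π²`. Consequently the double zero of the
numerator stays outside the closed disk. -/
theorem BicentricData.norm_coeff : ‖coeff₂ a y c k‖ < ‖coeff₀ a y c k‖ := by
  apply lt_of_pow_lt_pow_left₀ 2 (norm_nonneg _)
  have hy : 0 < y.im := by
    have h1 := d.im_y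
    have h2 := mul_pos d.c_pos d.k_pos
    have h3 := d.c_pos
    have h4 := d.k_pos
    exact pos_of_mul_pos_left (a := y.im) (b := 1 + c * k) (by rw [h1]; linarith) (by linarith)
  have ha : ‖a‖ = 1 := by
    rw [Complex.norm_def, Complex.normSq_apply, ← sq, ← sq, d.norm_a, sqrt_one]
  rw [coeff₀, coeff₂, norm_div, norm_div, norm_mul, ha, one_mul, div_pow, div_pow]
  have : 0 < ‖(π : ℂ)‖ ^ 2 := by
    have : (π : ℂ) ≠ 0 := by exact_mod_cast pi_ne_zero
    positivity
  apply div_lt_div_of_pos_right _ this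
  rw [← Complex.normSq_eq_norm_sq, ← Complex.normSq_eq_norm_sq, Complex.normSq_apply,
    Complex.normSq_apply]
  simp
  have h : 0 < 8 * a.im * c * k * y.im := by
    have := d.c_pos
    have := d.k_pos
    have := d.im_a
    positivity
  have : (a.re ^ 2 + a.im ^ 2 - 1) * (4 * c * k * y.re) = 0 := by rw [d.norm_a]; ring
  linarith

/-- The numerator of the derivative of the height function. -/
theorem BicentricData.height_numerator (z : ℂ) :
    (1 + c * k) * (π ^ 2 * (coeff₀ a y c k + coeff₁ a y S T * z + coeff₂ a y c k * z ^ 2) *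
      (coeff₀ a (conj y) (-c) (-k) + coeff₁ a (conj y) S T * z +
        coeff₂ a (conj y) (-c) (-k) * z ^ 2)) =
    -((a * (S * k - c * T) + (S * k + c * T)) * z ^ 2 + (a ^ 2 - 1) * (c + k) * z
      - a * (a * (S * k + c * T) + (S * k - c * T))) ^ 2 := by
  have hpi : (π : ℂ) ≠ 0 := by exact_mod_cast pi_ne_zero
  have r1 := d.y_mul_conj
  have r2 := d.y_add_conj
  have r3 := d.sq_add_sq_complex
  have r4 := d.sq_add_sq_complex'
  have r5 := d.y_sub_conj
  have ra := d.a_sq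
  -- `z4`, `z0`, `z3`, `z1`, `z2` compare the coefficients of the corresponding powers of `z`.
  have z4 : (1 + c * k) * ((a * (c * y + k) - (c * y - k)) *
      (a * (c * conj y + k) - (c * conj y - k))) =
      (a * (S * k - c * T) + (S * k + c * T)) ^ 2 := by
    linear_combination (1 + c * k) * c ^ 2 * (a - 1) ^ 2 * r1 + c * k * (a ^ 2 - 1) * r2
      - (a + 1) ^ 2 * k ^ 2 * r3 - (a - 1) ^ 2 * c ^ 2 * r4 + c * k * (c + k) * ra
  have z0 : (1 + c * k) * ((a * (c * y - k) - (c * y + k)) *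
      (a * (c * conj y - k) - (c * conj y + k))) =
      (a * (S * k + c * T) + (S * k - c * T)) ^ 2 := by
    linear_combination (1 + c * k) * c ^ 2 * (a - 1) ^ 2 * r1 + c * k * (1 - a ^ 2) * r2
      - (a + 1) ^ 2 * k ^ 2 * r3 - (a - 1) ^ 2 * c ^ 2 * r4 + c * k * (c + k) * ra
  have z3 : (1 + c * k) * ((a * (c * y + k) - (c * y - k)) * (S * conj y + T)
      - (a * (c * conj y + k) - (c * conj y - k)) * (S * y + T)) =
      -2 * Complex.I * (c + k) * (a * (S * k - c * T) + (S * k + c * T)) := by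
    linear_combination (-(a * (S * k - c * T) + (S * k + c * T))) * r5
  have z1 : (1 + c * k) * ((a * (c * y - k) - (c * y + k)) * (S * conj y + T)
      - (a * (c * conj y - k) - (c * conj y + k)) * (S * y + T)) =
      2 * Complex.I * (c + k) * (a * (S * k + c * T) + (S * k - c * T)) := by
    linear_combination (a * (S * k + c * T) + (S * k - c * T)) * r5
  have z2 : (1 + c * k) * (a * ((a * (c * y + k) - (c * y - k)) *
      (a * (c * conj y - k) - (c * conj y + k)) + (a * (c * conj y + k) - (c * conj y - k)) *
      (a * (c * y - k) - (c * y + k))) + (a ^ 2 - 1) ^ 2 * (S * y + T) * (S * conj y + T)) =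
      (a ^ 2 - 1) ^ 2 * (c + k) ^ 2 - 2 * a * (a * (S * k - c * T) + (S * k + c * T)) *
      (a * (S * k + c * T) + (S * k - c * T)) := by
    linear_combination (1 + c * k) * (a * ((a ^ 2 + 1) * 2 * c ^ 2 - 4 * a * c ^ 2)
      + (a ^ 2 - 1) ^ 2 * S ^ 2) * r1 + (a ^ 2 - 1) ^ 2 * S * T * r2
      + ((a ^ 2 - 1) ^ 2 * ((1 + c * k) - 2 * T ^ 2) + 2 * a * ((a ^ 2 + 1) + 2 * a) * k ^ 2) * r3
      + ((a ^ 2 - 1) ^ 2 * ((1 + c * k) - 2 * (1 - c ^ 2))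
        + 2 * a * (2 * a - (a ^ 2 + 1)) * c ^ 2) * r4
      - c * k * (a ^ 2 + 1) * (c + k) * ra
  rw [coeff₀, coeff₁, coeff₂, coeff₀, coeff₁, coeff₂]
  field_simp
  linear_combination (-z ^ 4) * z4 - a ^ 2 * z0 - Complex.I * (a ^ 2 - 1) * z ^ 3 * z3
    - Complex.I * a * (a ^ 2 - 1) * z * z1 - z ^ 2 * z2
    + ((1 + c * k) * (a ^ 2 - 1) ^ 2 * (S * y + T) * (S * conj y + T) * z ^ 2
      + 2 * (a ^ 2 - 1) * (c + k) * (a * (S * k - c * T) + (S * k + c * T)) * z ^ 3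
      - 2 * a * (a ^ 2 - 1) * (c + k) * (a * (S * k + c * T) + (S * k - c * T)) * z)
      * Complex.I_sq

end

theorem hasFDerivAt_projection (p q : ℝ) {z : ℂ} (hz : ‖z‖ < 1) :
    HasFDerivAt (projection p q)
      (realLinear
        (analyticPart (circleMap 0 1 (arcParam p q)) (bisector p q) (cos (q - p))
          (-cos p) (sin (q - p)) (sin p) z)
        (conj (analyticPart (circleMap 0 1 (arcParam p q)) (conj (bisector p q)) (cos (q - p))
          (-cos p) (-sin (q - p)) (-sin p) z))) z := by
  have h := ((((hasFDerivAt_harmonicMeasure 0 (arcParam p q) hz).mul_const (vertex₁ p q)).add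
    ((hasFDerivAt_harmonicMeasure (arcParam p q) π hz).mul_const (vertex₂ p q))).add
    ((hasFDerivAt_harmonicMeasure π (π + arcParam p q) hz).mul_const (vertex₃ p q))).add
    ((hasFDerivAt_harmonicMeasure (π + arcParam p q) (2 * π) hz).mul_const (vertex₄ p q))
  refine h.congr_fderiv ?_
  have c0 : circleMap 0 1 0 = 1 := by simp [circleMap_zero]
  have c1 : circleMap 0 1 π = -1 := by simp [circleMap_zero]
  have c2 : circleMap 0 1 (2 * π) = 1 := by simp [circleMap_zero]
  have c3 : circleMap 0 1 (π + arcParam p q) = -circleMap 0 1 (arcParam p q) := by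
    rw [circleMap_zero_one_add, c1]; ring
  have h2' : conj (2 : ℂ) = 2 := Complex.conj_ofNat 2
  ext v
  simp only [_root_.add_apply, _root_.smul_apply, realLinear_apply, smul_eq_mul,
    harmonicMeasureDeriv, analyticPart, c0, c1, c2, c3, vertex₁_eq, vertex₂_eq, vertex₃_eq,
    vertex₄_eq, map_add, map_sub, map_mul, map_div₀, map_neg, map_one, Complex.conj_I,
    Complex.conj_ofReal, Complex.conj_conj, h2']
  ring

/-! ### Curvature of a graph in a conformal parameter -/

/-- Two curves in the plane with the same square have the same derivative up to sign. -/
theorem deriv_eq_or_eq_neg_of_sq_eq {y φ : ℝ → ℂ} {y' φ' : ℂ} (hy : HasDerivAt y y' 0)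
    (hφ : HasDerivAt φ φ' 0) (h : ∀ᶠ s in nhds (0 : ℝ), y s ^ 2 = φ s ^ 2) :
    y' = φ' ∨ y' = -φ' := by
  have h0 : y 0 ^ 2 = φ 0 ^ 2 := h.self_of_nhds
  -- At a zero, compare the squares of the difference quotients; elsewhere, differentiate the
  -- squares.
  by_cases hz : φ 0 = 0
  · have hy0 : y 0 = 0 := by rw [hz] at h0; simpa using h0
    rw [hasDerivAt_iff_tendsto_slope] at hy hφ
    apply sq_eq_sq_iff_eq_or_eq_neg.1
    refine tendsto_nhds_unique (hy.pow 2) ((hφ.pow 2).congr' ?_)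
    filter_upwards [h.filter_mono nhdsWithin_le_nhds] with s hs
    simp [slope, hz, hy0, mul_pow, hs]
  · have h1 : HasDerivAt (fun s => y s ^ 2) (2 * y 0 * y') 0 := by
      simpa using hy.fun_pow 2
    have h2 : HasDerivAt (fun s => φ s ^ 2) (2 * φ 0 * φ') 0 := by
      simpa using hφ.fun_pow 2
    have h3 := h1.unique (h2.congr_of_eventuallyEq h)
    rcases sq_eq_sq_iff_eq_or_eq_neg.1 h0 with h4 | h4
    · left
      rw [h4] at h3
      exact mul_left_cancel₀ (mul_ne_zero two_ne_zero hz) h3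
    · right
      rw [h4] at h3
      exact mul_left_cancel₀ (mul_ne_zero two_ne_zero hz) (by linear_combination -h3)

/-- The Jacobian determinant of the real-linear map with the given values at `1` and `i`. -/
def jacobian (v w : ℂ) : ℝ := v.re * w.im - v.im * w.re

theorem abs_jacobian_eq {v w v' w' : ℂ} (hv : v = v' ∨ v = -v') (hw : w = w' ∨ w = -w') :
    |jacobian v w| = |jacobian v' w'| := by
  have neg_left : ∀ a b : ℂ, jacobian (-a) b = -jacobian a b := fun a b => by
    simp [jacobian]; ring
  have neg_right : ∀ a b : ℂ, jacobian a (-b) = -jacobian a b := fun a b => by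
    simp [jacobian]; ring
  rcases hv with rfl | rfl <;> rcases hw with rfl | rfl <;> simp [neg_left, neg_right]

theorem jacobian_comp (L : ℂ →L[ℝ] ℂ) (v w : ℂ) :
    jacobian (L v) (L w) = jacobian (L 1) (L Complex.I) * jacobian v w := by
  have h : ∀ x : ℂ, L x = x.re • L 1 + x.im • L Complex.I := fun x => by
    rw [← map_smul, ← map_smul, ← map_add]
    congr 1
    simp
  rw [h v, h w]
  simp [jacobian]
  ring

theorem jacobian_realLinear (a b : ℂ) :
    jacobian (realLinear a b 1) (realLinear a b Complex.I) = ‖a‖ ^ 2 - ‖b‖ ^ 2 := by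
  rw [← Complex.normSq_eq_norm_sq, ← Complex.normSq_eq_norm_sq, Complex.normSq_apply,
    Complex.normSq_apply]
  simp [jacobian]
  ring

/-- Half of the conjugate of the gradient. -/
def halfGradient (u : ℂ → ℝ) (w : ℂ) : ℂ := (dx u w - dy u w * Complex.I) / 2

theorem fderiv_eq_halfGradient (u : ℂ → ℝ) (w v : ℂ) :
    fderiv ℝ u w v = 2 * (halfGradient u w * v).re := by
  have h : v = v.re • (1 : ℂ) + v.im • Complex.I := by simp
  conv_lhs => rw [h]
  rw [map_add, map_smul, map_smul]
  simp [halfGradient, dx, dy]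
  ring

/-- In a conformal parameter, the gradient is determined up to sign by the square root of the
dilatation of the horizontal projection. -/
theorem halfGradient_of_conformal {f : ℂ → ℂ} {u : ℂ → ℝ} {z H Q : ℂ}
    (hf : HasFDerivAt f (realLinear H (conj (H * Q ^ 2))) z) (hu : DifferentiableAt ℝ u (f z))
    (hH : H ≠ 0) (hQ : ‖Q‖ < 1) (hc : ConformalParam f (fun ζ => u (f ζ)) z) :
    (halfGradient u (f z)) ^ 2 = (Complex.I * Q / (1 - Q * conj Q)) ^ 2 := by
  obtain ⟨c1, c2⟩ := hc
  have hfx : dx f z = H + conj (H * Q ^ 2) := by rw [dx, hf.fderiv]; simp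
  have hfy : dy f z = Complex.I * (H - conj (H * Q ^ 2)) := by
    rw [dy, hf.fderiv]; simp; ring
  have ht : ∀ v, fderiv ℝ (fun ζ => u (f ζ)) z v =
      2 * (halfGradient u (f z) * realLinear H (conj (H * Q ^ 2)) v).re := fun v => by
    rw [← fderiv_eq_halfGradient]
    have h := (hu.hasFDerivAt.comp z hf).fderiv
    rw [show (fun ζ => u (f ζ)) = u ∘ f from rfl, h]
    rfl
  have htx : dx (fun ζ => u (f ζ)) z = 2 * (halfGradient u (f z) * (H + conj (H * Q ^ 2))).re := by
    rw [dx, ht]; simp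
  have hty : dy (fun ζ => u (f ζ)) z =
      2 * (halfGradient u (f z) * (Complex.I * (H - conj (H * Q ^ 2)))).re := by
    rw [dy, ht]; congr 3; simp; ring
  rw [hfx, hfy, htx, hty] at c1 c2
  generalize halfGradient u (f z) = U at *
  obtain ⟨G, hG⟩ : ∃ G, G = H * Q ^ 2 := ⟨_, rfl⟩
  rw [← hG] at c1 c2
  -- With `t = u ∘ f` the chain rule gives `t_z = UH + ŪG`, and conformality is `t_z² = -HG`.
  have key : (U * H + conj U * G) ^ 2 = -(H * G) := by
    rw [← Complex.normSq_eq_norm_sq, ← Complex.normSq_eq_norm_sq, Complex.normSq_apply,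
      Complex.normSq_apply] at c1
    rw [Complex.inner] at c2
    simp at c1 c2
    apply Complex.ext
    · simp [sq]
      linarith
    · simp [sq]
      linarith
  have key2 : (U + conj U * Q ^ 2) ^ 2 = (Complex.I * Q) ^ 2 := by
    have : H ^ 2 * (U + conj U * Q ^ 2) ^ 2 = H ^ 2 * (Complex.I * Q) ^ 2 := by
      rw [hG] at key
      linear_combination key - H ^ 2 * Q ^ 2 * Complex.I_sq
    exact mul_left_cancel₀ (pow_ne_zero 2 hH) this
  have hρ : Q * conj Q = ((‖Q‖ ^ 2 : ℝ) : ℂ) := by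
    rw [Complex.mul_conj, Complex.normSq_eq_norm_sq]
  have hρ1 : ‖Q‖ ^ 2 < 1 := by
    have := norm_nonneg Q
    nlinarith
  have hm : (1 : ℂ) - Q * conj Q ≠ 0 := by
    rw [hρ]
    have : (1 : ℝ) - ‖Q‖ ^ 2 ≠ 0 := by linarith
    exact_mod_cast this
  have hp : (1 : ℂ) + Q * conj Q ≠ 0 := by
    rw [hρ]
    have : (1 : ℝ) + ‖Q‖ ^ 2 ≠ 0 := by positivity
    exact_mod_cast this
  rw [div_pow, eq_div_iff (pow_ne_zero 2 hm), ← mul_pow]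
  -- A real-linear equation for `U`: eliminating `Ū` with the conjugate equation leaves the common
  -- factor `1 + |Q|²`.
  have aux : ∀ σ : ℂ, conj σ = σ → U + conj U * Q ^ 2 = σ * (Complex.I * Q) →
      U * (1 - Q * conj Q) = σ * (Complex.I * Q) := by
    intro σ hσ hU
    have hU' := congrArg conj hU
    simp only [map_add, map_mul, map_pow, Complex.conj_conj, Complex.conj_I, hσ] at hU'
    apply mul_right_cancel₀ hp
    linear_combination hU - Q ^ 2 * hU'
  rcases sq_eq_sq_iff_eq_or_eq_neg.1 key2 with h | h
  · rw [aux 1 (map_one _) (by rw [h]; ring)]; ring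
  · rw [aux (-1) (by simp) (by rw [h]; ring)]; ring

theorem hasDerivAt_stereographic {Q : ℂ → ℂ} {z Q' v : ℂ} (hQ : HasDerivAt Q Q' z)
    (hQ1 : 1 - Q z * conj (Q z) ≠ 0) :
    HasDerivAt (fun s : ℝ => Complex.I * Q (z + s * v) /
        (1 - Q (z + s * v) * conj (Q (z + s * v))))
      (realLinear (Complex.I * Q' / (1 - Q z * conj (Q z)) ^ 2)
        (Complex.I * Q z ^ 2 * conj Q' / (1 - Q z * conj (Q z)) ^ 2) v) 0 := by
  have hc : HasDerivAt (fun s : ℝ => z + s * v) v 0 := by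
    simpa using ((Complex.ofRealCLM.hasDerivAt (x := (0 : ℝ))).mul_const v).const_add z
  have h1 : HasDerivAt (fun s : ℝ => Q (z + s * v)) (Q' * v) 0 := by
    have := (hQ.hasFDerivAt.restrictScalars ℝ).comp_hasDerivAt_of_eq 0 hc (by simp)
    refine this.congr_deriv ?_
    simp [mul_comm]
  have h2 : HasDerivAt (fun s : ℝ => conj (Q (z + s * v))) (conj (Q' * v)) 0 :=
    (Complex.conjCLE : ℂ →L[ℝ] ℂ).hasFDerivAt.comp_hasDerivAt 0 h1
  have h3 := (h1.const_mul Complex.I).fun_div ((h1.fun_mul h2).const_sub 1) (by simpa using hQ1)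
  refine h3.congr_deriv ?_
  simp only [Complex.ofReal_zero, zero_mul, add_zero, realLinear_apply, map_mul]
  field_simp
  ring

theorem hasFDerivAt_halfGradient {u : ℂ → ℝ} {w : ℂ} (hu : ContDiffAt ℝ 2 u w) :
    ∃ L : ℂ →L[ℝ] ℂ, HasFDerivAt (halfGradient u) L w ∧
      jacobian (L 1) (L Complex.I) =
        -(dx (dx u) w * dy (dy u) w - dy (dx u) w ^ 2) / 4 := by
  have h1 : DifferentiableAt ℝ (fderiv ℝ u) w :=
    (hu.fderiv_right (m := 1) (by norm_num)).differentiableAt (by norm_num)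
  have hx : HasFDerivAt (dx u) _ w := h1.hasFDerivAt.clm_apply (hasFDerivAt_const 1 w)
  have hy : HasFDerivAt (dy u) _ w := h1.hasFDerivAt.clm_apply (hasFDerivAt_const Complex.I w)
  have hsymm : IsSymmSndFDerivAt ℝ u w := hu.isSymmSndFDerivAt (by simp)
  have hL : HasFDerivAt (halfGradient u) _ w :=
    (((Complex.ofRealCLM.hasFDerivAt.comp w hx).sub
      ((Complex.ofRealCLM.hasFDerivAt.comp w hy).mul_const Complex.I)).mul_const (1 / 2 : ℂ)).congr_of_eventuallyEq
      (Filter.Eventually.of_forall fun x => by simp [halfGradient]; ring)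
  refine ⟨_, hL, ?_⟩
  have e : dx (dy u) w = dy (dx u) w := by
    rw [dx, dy, hx.fderiv, hy.fderiv]
    simpa using hsymm 1 Complex.I
  rw [dx, dy, dy, hx.fderiv, hy.fderiv]
  rw [dx, dy, hx.fderiv, hy.fderiv] at e
  simp [jacobian] at e ⊢
  rw [e]
  ring

/-- The curvature of a minimal graph in terms of its Weierstrass data: the horizontal projection
has the `z`-derivative `H` and the dilatation `Q ^ 2`. -/
theorem sq_slopeFactor_mul_abs_gaussCurvature {f H Q : ℂ → ℂ} {u : ℂ → ℝ} {s : Set ℂ}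
    {z Q' : ℂ} (hs : IsOpen s) (hz : z ∈ s)
    (hf : ∀ ζ ∈ s, HasFDerivAt f (realLinear (H ζ) (conj (H ζ * Q ζ ^ 2))) ζ)
    (hH : ∀ ζ ∈ s, H ζ ≠ 0) (hQ : ∀ ζ ∈ s, ‖Q ζ‖ < 1) (hQ' : HasDerivAt Q Q' z)
    (hu : ∀ ζ ∈ s, ContDiffAt ℝ 2 u (f ζ))
    (hc : ∀ ζ ∈ s, ConformalParam f (fun ζ => u (f ζ)) ζ) :
    slopeFactor u (f z) ^ 2 * |gaussCurvature u (f z)| *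
      (‖H z‖ * (1 + ‖Q z‖ ^ 2) * (1 - ‖Q z‖ ^ 2)) ^ 2 = 4 * ‖Q'‖ ^ 2 := by
  have hsq : ∀ ζ ∈ s, halfGradient u (f ζ) ^ 2 =
      (Complex.I * Q ζ / (1 - Q ζ * conj (Q ζ))) ^ 2 := fun ζ hζ =>
    halfGradient_of_conformal (hf ζ hζ) ((hu ζ hζ).differentiableAt (by norm_num)) (hH ζ hζ)
      (hQ ζ hζ) (hc ζ hζ)
  obtain ⟨ρ, hρ⟩ : ∃ ρ, ρ = ‖Q z‖ ^ 2 := ⟨_, rfl⟩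
  have hρ0 : 0 ≤ ρ := by rw [hρ]; positivity
  have hρ1 : ρ < 1 := by
    rw [hρ]
    have := hQ z hz
    have := norm_nonneg (Q z)
    nlinarith
  have hρc : Q z * conj (Q z) = (ρ : ℂ) := by
    rw [Complex.mul_conj, Complex.normSq_eq_norm_sq, hρ]
  have hm : (1 : ℂ) - Q z * conj (Q z) = ((1 - ρ : ℝ) : ℂ) := by rw [hρc]; push_cast; ring
  have hm0 : (1 : ℝ) - ρ ≠ 0 := by linarith
  have hmc : (1 : ℂ) - Q z * conj (Q z) ≠ 0 := by rw [hm]; exact_mod_cast hm0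
  obtain ⟨L, hL, hLj⟩ := hasFDerivAt_halfGradient (hu z hz)
  have hcurve : ∀ v : ℂ, HasDerivAt (fun t : ℝ => z + t * v) v 0 := fun v => by
    simpa using ((Complex.ofRealCLM.hasDerivAt (x := (0 : ℝ))).mul_const v).const_add z
  -- Only the square of the gradient is known, and its sign might vary with the point. Each
  -- directional derivative is still known up to sign, which is enough for the absolute Jacobian.
  have hsign : ∀ v : ℂ, L (realLinear (H z) (conj (H z * Q z ^ 2)) v) =
        realLinear (Complex.I * Q' / (1 - Q z * conj (Q z)) ^ 2)
          (Complex.I * Q z ^ 2 * conj Q' / (1 - Q z * conj (Q z)) ^ 2) v ∨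
      L (realLinear (H z) (conj (H z * Q z ^ 2)) v) =
        -realLinear (Complex.I * Q' / (1 - Q z * conj (Q z)) ^ 2)
          (Complex.I * Q z ^ 2 * conj Q' / (1 - Q z * conj (Q z)) ^ 2) v := by
    intro v
    have h1 : HasDerivAt (fun t : ℝ => halfGradient u (f (z + t * v)))
        (L (realLinear (H z) (conj (H z * Q z ^ 2)) v)) 0 :=
      (hL.comp z (hf z hz)).comp_hasDerivAt_of_eq 0 (hcurve v) (by simp)
    refine deriv_eq_or_eq_neg_of_sq_eq h1 (hasDerivAt_stereographic hQ' hmc) ?_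
    have hcont : Filter.Tendsto (fun t : ℝ => z + t * v) (nhds 0) (nhds z) := by
      have := (hcurve v).continuousAt.tendsto
      simpa using this
    filter_upwards [hcont.eventually (hs.mem_nhds hz)] with t ht
    exact hsq _ ht
  have hjac := abs_jacobian_eq (hsign 1) (hsign Complex.I)
  rw [jacobian_comp, jacobian_realLinear, jacobian_realLinear, hLj] at hjac
  simp only [hm, norm_div, norm_mul, norm_pow, RCLike.norm_conj, Complex.norm_I, one_mul,
    Complex.norm_real, Real.norm_eq_abs, abs_of_pos (by linarith : 0 < 1 - ρ), ← hρ] at hjac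
  have hgrad : 1 + dx u (f z) ^ 2 + dy u (f z) ^ 2 = ((1 + ρ) / (1 - ρ)) ^ 2 := by
    have h1 := congrArg (fun x : ℂ => ‖x‖) (hsq z hz)
    simp only [hm, norm_div, norm_mul, norm_pow, Complex.norm_I, one_mul,
      Complex.norm_real, Real.norm_eq_abs, abs_of_pos (by linarith : 0 < 1 - ρ), div_pow, ← hρ]
      at h1
    have h2 : ‖halfGradient u (f z)‖ ^ 2 = (dx u (f z) ^ 2 + dy u (f z) ^ 2) / 4 := by
      rw [← Complex.normSq_eq_norm_sq, Complex.normSq_apply]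
      simp [halfGradient]
      ring
    rw [h2, div_eq_div_iff (by norm_num) (pow_ne_zero 2 hm0)] at h1
    rw [div_pow, eq_div_iff (pow_ne_zero 2 hm0)]
    linarith
  rw [slopeFactor, gaussCurvature, hgrad, sqrt_sq (by positivity), abs_div]
  generalize dx (dx u) (f z) * dy (dy u) (f z) - dy (dx u) (f z) ^ 2 = J at *
  rw [abs_of_nonneg (by positivity : 0 ≤ (((1 + ρ) / (1 - ρ)) ^ 2) ^ 2)]
  have hJ : |J| * ‖H z‖ ^ 2 * (1 - ρ) ^ 4 = 4 * ‖Q'‖ ^ 2 := by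
    have hρ2 : 0 < 1 - ρ ^ 2 := by nlinarith
    have e1 : -J / 4 * (‖H z‖ ^ 2 - (‖H z‖ * ρ) ^ 2) = J * (-(‖H z‖ ^ 2 * (1 - ρ ^ 2)) / 4) := by
      ring
    have e2 : (‖Q'‖ / (1 - ρ) ^ 2) ^ 2 - (ρ * ‖Q'‖ / (1 - ρ) ^ 2) ^ 2 =
        ‖Q'‖ ^ 2 * (1 - ρ ^ 2) / (1 - ρ) ^ 4 := by
      rw [div_pow, div_pow, ← sub_div, ← pow_mul]
      congr 1
      ring
    have e3 : 0 ≤ ‖H z‖ ^ 2 * (1 - ρ ^ 2) := by positivity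
    rw [e1, e2, abs_mul, abs_of_nonpos (by linarith : -(‖H z‖ ^ 2 * (1 - ρ ^ 2)) / 4 ≤ 0),
      abs_of_nonneg (by positivity : 0 ≤ ‖Q'‖ ^ 2 * (1 - ρ ^ 2) / (1 - ρ) ^ 4), eq_div_iff (pow_ne_zero 4 hm0)] at hjac
    apply mul_right_cancel₀ hρ2.ne'
    linarith
  rw [← hJ, ← hρ]
  field_simp

/-! ### The energy as a quadratic form -/

/-- The Euclidean inner product of the plane. -/
def dot (v w : ℂ) : ℝ := v.re * w.re + v.im * w.im

theorem dot_comm (v w : ℂ) : dot v w = dot w v := by simp [dot]; ring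

theorem dot_sub_left (v v' w : ℂ) : dot (v - v') w = dot v w - dot v' w := by simp [dot]; ring

theorem dot_sub_right (v w w' : ℂ) : dot v (w - w') = dot v w - dot v w' := by simp [dot]; ring

/-- Conjugating the coefficients reverses the sign of the products of oriented areas, so only scalar
products survive in the sum. -/
theorem normSq_sum_add_normSq_sum_conj {D₁ D₂ D₃ D₄ w₁ w₂ w₃ w₄ : ℂ} (h₁ : dot w₁ w₁ = 1)
    (h₂ : dot w₂ w₂ = 1) (h₃ : dot w₃ w₃ = 1) (h₄ : dot w₄ w₄ = 1) :
    Complex.normSq (D₁ * w₁ + D₂ * w₂ + D₃ * w₃ + D₄ * w₄) +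
      Complex.normSq (conj D₁ * w₁ + conj D₂ * w₂ + conj D₃ * w₃ + conj D₄ * w₄) =
    2 * (dot D₁ D₁ + dot D₂ D₂ + dot D₃ D₃ + dot D₄ D₄ + 2 * (dot D₁ D₂ * dot w₁ w₂
      + dot D₂ D₃ * dot w₂ w₃ + dot D₃ D₄ * dot w₃ w₄ + dot D₄ D₁ * dot w₄ w₁
      + dot D₁ D₃ * dot w₁ w₃ + dot D₂ D₄ * dot w₂ w₄)) := by
  simp only [dot, Complex.normSq_apply, Complex.add_re, Complex.add_im, Complex.mul_re,
    Complex.mul_im, Complex.conj_re, Complex.conj_im] at *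
  linear_combination 2 * (D₁.re * D₁.re + D₁.im * D₁.im) * h₁
    + 2 * (D₂.re * D₂.re + D₂.im * D₂.im) * h₂ + 2 * (D₃.re * D₃.re + D₃.im * D₃.im) * h₃
    + 2 * (D₄.re * D₄.re + D₄.im * D₄.im) * h₄

theorem normSq_alternating_sum {s₁ s₂ s₃ s₄ : ℝ} {w₁ w₂ w₃ w₄ : ℂ} (h₁ : dot w₁ w₁ = 1)
    (h₂ : dot w₂ w₂ = 1) (h₃ : dot w₃ w₃ = 1) (h₄ : dot w₄ w₄ = 1) :
    Complex.normSq (s₁ * w₁ - s₂ * w₂ + s₃ * w₃ - s₄ * w₄) =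
    s₁ ^ 2 + s₂ ^ 2 + s₃ ^ 2 + s₄ ^ 2 + 2 * (-(s₁ * s₂) * dot w₁ w₂
      - s₂ * s₃ * dot w₂ w₃ - s₃ * s₄ * dot w₃ w₄ - s₄ * s₁ * dot w₄ w₁
      + s₁ * s₃ * dot w₁ w₃ + s₂ * s₄ * dot w₂ w₄) := by
  simp only [dot, Complex.normSq_apply, Complex.add_re, Complex.add_im, Complex.sub_re,
    Complex.sub_im, Complex.re_ofReal_mul, Complex.im_ofReal_mul] at *
  linear_combination s₁ ^ 2 * h₁ + s₂ ^ 2 * h₂ + s₃ ^ 2 * h₃ + s₄ ^ 2 * h₄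

theorem neg_one_le_dot {v w : ℂ} (hv : dot v v = 1) (hw : dot w w = 1) : -1 ≤ dot v w := by
  simp only [dot] at *
  nlinarith [sq_nonneg (v.re + w.re), sq_nonneg (v.im + w.im)]

section

variable {S T c k : ℝ} {y a : ℂ} (d : BicentricData S T c k y a)
include d

/-- Lower bound for the conformal factor in terms of the angles between the jump points. -/
theorem BicentricData.energy_lower_bound {P₁ P₂ P₃ P₄ w₁ w₂ w₃ w₄ : ℂ}
    (hP₁ : P₁ = y * (S + c * Complex.I)) (hP₂ : P₂ = -T - k * Complex.I)
    (hP₃ : P₃ = y * (S - c * Complex.I)) (hP₄ : P₄ = -T + k * Complex.I)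
    (h₁ : dot w₁ w₁ = 1) (h₂ : dot w₂ w₂ = 1) (h₃ : dot w₃ w₃ = 1) (h₄ : dot w₄ w₄ = 1) :
    32 * (1 + c * k) - 16 * (c * k * (S ^ 2 + T ^ 2) + 2 * S ^ 2 * T ^ 2)
      - 8 * (c + k) * (k * ((1 + S) ^ 2 * dot w₁ w₂ + (1 - S) ^ 2 * dot w₃ w₄)
        + c * ((1 + T) ^ 2 * dot w₂ w₃ + (1 - T) ^ 2 * dot w₄ w₁)) ≤
    (1 + c * k) * (Complex.normSq ((P₁ - P₂) * w₁ + (P₂ - P₃) * w₂ + (P₃ - P₄) * w₃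
        + (P₄ - P₁) * w₄) +
      Complex.normSq (conj (P₁ - P₂) * w₁ + conj (P₂ - P₃) * w₂ + conj (P₃ - P₄) * w₃
        + conj (P₄ - P₁) * w₄)) +
    8 * Complex.normSq ((((c + k) + (S * k - c * T)) / 2 : ℝ) * w₁
      - (((c + k) + (S * k + c * T)) / 2 : ℝ) * w₂ + (((c + k) - (S * k - c * T)) / 2 : ℝ) * w₃
      - (((c + k) - (S * k + c * T)) / 2 : ℝ) * w₄) := by
  have hc := d.c_pos
  have hk := d.k_pos
  have r3 := d.sq_add_sq
  have r4 := d.sq_add_sq'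
  have ry := d.norm_y
  have rr := d.re_y
  have ri := d.im_y
  have g11 : dot P₁ P₁ = 1 := by
    rw [hP₁]; simp [dot]; linear_combination (S ^ 2 + c ^ 2) * ry + r3
  have g33 : dot P₃ P₃ = 1 := by
    rw [hP₃]; simp [dot]; linear_combination (S ^ 2 + c ^ 2) * ry + r3
  have g22 : dot P₂ P₂ = 1 := by rw [hP₂]; simp [dot]; linear_combination r4
  have g44 : dot P₄ P₄ = 1 := by rw [hP₄]; simp [dot]; linear_combination r4
  have g13 : dot P₁ P₃ = 2 * S ^ 2 - 1 := by
    rw [hP₁, hP₃]; simp [dot]; linear_combination (S ^ 2 - c ^ 2) * ry - r3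
  have g24 : dot P₂ P₄ = 2 * T ^ 2 - 1 := by
    rw [hP₂, hP₄]; simp [dot]; linear_combination -r4
  have g12 : (1 + c * k) * dot P₁ P₂ = S * T * (S * T + c * k) - (c + k) * (S * k - c * T) := by
    rw [hP₁, hP₂]; simp [dot]
    linear_combination (-(S * T) - c * k) * rr - (S * k - c * T) * ri
  have g23 : (1 + c * k) * dot P₂ P₃ = S * T * (S * T - c * k) - (c + k) * (S * k + c * T) := by
    rw [hP₂, hP₃]; simp [dot]
    linear_combination (-(S * T) + c * k) * rr - (S * k + c * T) * ri
  have g34 : (1 + c * k) * dot P₃ P₄ = S * T * (S * T + c * k) + (c + k) * (S * k - c * T) := by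
    rw [hP₃, hP₄]; simp [dot]
    linear_combination (-(S * T) - c * k) * rr + (S * k - c * T) * ri
  have g41 : (1 + c * k) * dot P₄ P₁ = S * T * (S * T - c * k) + (c + k) * (S * k + c * T) := by
    rw [hP₄, hP₁]; simp [dot]
    linear_combination (-(S * T) + c * k) * rr + (S * k + c * T) * ri
  rw [normSq_sum_add_normSq_sum_conj h₁ h₂ h₃ h₄, normSq_alternating_sum h₁ h₂ h₃ h₄]
  have hμ : 0 < 1 + c * k := by positivity
  generalize hD₁ : P₁ - P₂ = D₁
  generalize hD₂ : P₂ - P₃ = D₂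
  generalize hD₃ : P₃ - P₄ = D₃
  generalize hD₄ : P₄ - P₁ = D₄
  generalize hs₁ : ((c + k) + (S * k - c * T)) / 2 = s₁
  generalize hs₂ : ((c + k) + (S * k + c * T)) / 2 = s₂
  generalize hs₃ : ((c + k) - (S * k - c * T)) / 2 = s₃
  generalize hs₄ : ((c + k) - (S * k + c * T)) / 2 = s₄
  -- The sides have lengths `2 s_j / √(1 + ck)`, and `s₁ + s₃ = s₂ + s₄` is the condition for an
  -- inscribed circle.
  have d11 : (1 + c * k) * dot D₁ D₁ = 4 * s₁ ^ 2 := by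
    rw [← hD₁, ← hs₁]
    simp only [dot_sub_left, dot_sub_right, g11, g22, dot_comm P₂ P₁]
    linear_combination -2 * g12 - (1 + T ^ 2) * r3 - (1 + S ^ 2) * r4
  have d22 : (1 + c * k) * dot D₂ D₂ = 4 * s₂ ^ 2 := by
    rw [← hD₂, ← hs₂]
    simp only [dot_sub_left, dot_sub_right, g22, g33, dot_comm P₃ P₂]
    linear_combination -2 * g23 - (1 + T ^ 2) * r3 - (1 + S ^ 2) * r4
  have d33 : (1 + c * k) * dot D₃ D₃ = 4 * s₃ ^ 2 := by
    rw [← hD₃, ← hs₃]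
    simp only [dot_sub_left, dot_sub_right, g33, g44, dot_comm P₄ P₃]
    linear_combination -2 * g34 - (1 + T ^ 2) * r3 - (1 + S ^ 2) * r4
  have d44 : (1 + c * k) * dot D₄ D₄ = 4 * s₄ ^ 2 := by
    rw [← hD₄, ← hs₄]
    simp only [dot_sub_left, dot_sub_right, g11, g44, dot_comm P₁ P₄]
    linear_combination -2 * g41 - (1 + T ^ 2) * r3 - (1 + S ^ 2) * r4
  have d12 : (1 + c * k) * dot D₁ D₂ - 4 * (s₁ * s₂) = -2 * k * (c + k) * (1 + S) ^ 2 := by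
    rw [← hD₁, ← hD₂, ← hs₁, ← hs₂]
    simp only [dot_sub_left, dot_sub_right, g22, g13]
    linear_combination g12 + g23 + (2 * S ^ 2 + c ^ 2) * r4 - k ^ 2 * r3
  have d34 : (1 + c * k) * dot D₃ D₄ - 4 * (s₃ * s₄) = -2 * k * (c + k) * (1 - S) ^ 2 := by
    rw [← hD₃, ← hD₄, ← hs₃, ← hs₄]
    simp only [dot_sub_left, dot_sub_right, g44, dot_comm P₃ P₁, g13]
    linear_combination g34 + g41 + (2 * S ^ 2 + c ^ 2) * r4 - k ^ 2 * r3
  have d23 : (1 + c * k) * dot D₂ D₃ - 4 * (s₂ * s₃) = -2 * c * (c + k) * (1 + T) ^ 2 := by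
    rw [← hD₂, ← hD₃, ← hs₂, ← hs₃]
    simp only [dot_sub_left, dot_sub_right, g33, g24]
    linear_combination g23 + g34 + (2 * T ^ 2 + k ^ 2) * r3 - c ^ 2 * r4
  have d41 : (1 + c * k) * dot D₄ D₁ - 4 * (s₄ * s₁) = -2 * c * (c + k) * (1 - T) ^ 2 := by
    rw [← hD₄, ← hD₁, ← hs₄, ← hs₁]
    simp only [dot_sub_left, dot_sub_right, g11, dot_comm P₄ P₂, g24]
    linear_combination g41 + g12 + (2 * T ^ 2 + k ^ 2) * r3 - c ^ 2 * r4
  have d13 : (1 + c * k) * dot D₁ D₃ + 4 * (s₁ * s₃) = 2 * (c * k) * (S + T) ^ 2 := by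
    rw [← hD₁, ← hD₃, ← hs₁, ← hs₃]
    simp only [dot_sub_left, dot_sub_right, g13, g24]
    have g14 := g41
    rw [dot_comm] at g14
    linear_combination -g14 - g23 + (1 - T ^ 2) * r3 + (1 - S ^ 2) * r4
  have d24 : (1 + c * k) * dot D₂ D₄ + 4 * (s₂ * s₄) = 2 * (c * k) * (S - T) ^ 2 := by
    rw [← hD₂, ← hD₄, ← hs₂, ← hs₄]
    simp only [dot_sub_left, dot_sub_right, dot_comm P₃ P₁, g13, g24]
    have g21 := g12
    rw [dot_comm] at g21
    linear_combination -g21 - g34 + (1 - T ^ 2) * r3 + (1 - S ^ 2) * r4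
  have hσ : 4 * (s₁ ^ 2 + s₂ ^ 2 + s₃ ^ 2 + s₄ ^ 2) + 8 * S ^ 2 * T ^ 2 = 8 * (1 + c * k) := by
    rw [← hs₁, ← hs₂, ← hs₃, ← hs₄]
    linear_combination 8 * r3 + 8 * r4 - 4 * (1 - T ^ 2) * r3 - 4 * (1 - S ^ 2) * r4
  -- The products of opposite vectors have nonnegative coefficients, by `d13` and `d24`, so `-1` may
  -- replace them.
  have n13 := neg_one_le_dot h₁ h₃
  have n24 := neg_one_le_dot h₂ h₄
  have o13 : 0 ≤ (1 + c * k) * dot D₁ D₃ + 4 * (s₁ * s₃) := by rw [d13]; positivity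
  have o24 : 0 ≤ (1 + c * k) * dot D₂ D₄ + 4 * (s₂ * s₄) := by rw [d24]; positivity
  have f13 := mul_le_mul_of_nonneg_left n13 o13
  have f24 := mul_le_mul_of_nonneg_left n24 o24
  have e12 := congrArg (fun x => x * dot w₁ w₂) d12
  have e23 := congrArg (fun x => x * dot w₂ w₃) d23
  have e34 := congrArg (fun x => x * dot w₃ w₄) d34
  have e41 := congrArg (fun x => x * dot w₄ w₁) d41
  linarith

end

/-! ### Möbius transformations and the Gauss map -/

section

variable {m : ℂ} (hm : ‖m‖ < 1)
include hm

theorem one_sub_conj_mul_ne_zero {z : ℂ} (hz : ‖z‖ < 1) : 1 - conj m * z ≠ 0 := by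
  intro h
  have h1 : ‖conj m * z‖ = 1 := by rw [← sub_eq_zero.1 h, norm_one]
  rw [norm_mul, RCLike.norm_conj] at h1
  nlinarith [norm_nonneg z, norm_nonneg m]

theorem one_sub_sq_norm_mobius {z : ℂ} (hz : ‖z‖ < 1) :
    1 - ‖(z - m) / (1 - conj m * z)‖ ^ 2 =
      (1 - ‖z‖ ^ 2) * ((1 - ‖m‖ ^ 2) / ‖1 - conj m * z‖ ^ 2) := by
  have h : ‖1 - conj m * z‖ ^ 2 ≠ 0 :=
    pow_ne_zero 2 (norm_ne_zero_iff.2 (one_sub_conj_mul_ne_zero hm hz))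
  rw [norm_div, div_pow, one_sub_div h, mul_div_assoc']
  congr 1
  simp only [← Complex.normSq_eq_norm_sq, Complex.normSq_apply, Complex.sub_re, Complex.sub_im,
    Complex.mul_re, Complex.mul_im, Complex.conj_re, Complex.conj_im, Complex.one_re,
    Complex.one_im]
  ring

theorem norm_mobius_lt_one {z : ℂ} (hz : ‖z‖ < 1) : ‖(z - m) / (1 - conj m * z)‖ < 1 := by
  have h := one_sub_sq_norm_mobius hm hz
  have h1 : 0 < ‖1 - conj m * z‖ := norm_pos_iff.2 (one_sub_conj_mul_ne_zero hm hz)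
  have h2 : 0 < 1 - ‖z‖ ^ 2 := by nlinarith [norm_nonneg z]
  have h3 : 0 < 1 - ‖m‖ ^ 2 := by nlinarith [norm_nonneg m]
  have h4 : 0 < (1 - ‖z‖ ^ 2) * ((1 - ‖m‖ ^ 2) / ‖1 - conj m * z‖ ^ 2) := by positivity
  nlinarith [norm_nonneg ((z - m) / (1 - conj m * z))]

theorem hasDerivAt_mobius {z : ℂ} (hz : ‖z‖ < 1) :
    HasDerivAt (fun z => (z - m) / (1 - conj m * z))
      (((1 - ‖m‖ ^ 2 : ℝ) : ℂ) / (1 - conj m * z) ^ 2) z := by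
  have h1 : HasDerivAt (fun z => z - m) 1 z := (hasDerivAt_id z).sub_const m
  have h2 : HasDerivAt (fun z => 1 - conj m * z) (-(conj m * 1)) z :=
    ((hasDerivAt_id z).const_mul (conj m)).const_sub 1
  refine (h1.div h2 (one_sub_conj_mul_ne_zero hm hz)).congr_deriv ?_
  congr 1
  push_cast
  rw [← Complex.conj_mul']
  ring

end

section

variable {S T c k : ℝ} {y a : ℂ} (d : BicentricData S T c k y a)
include d

theorem BicentricData.norm_a_eq : ‖a‖ = 1 := by
  rw [Complex.norm_def, Complex.normSq_apply, ← sq, ← sq, d.norm_a, sqrt_one]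

/-- The Weierstrass data of the harmonic extension: the Gauss map is, up to a rotation, a
Möbius transformation of the disk. -/
theorem BicentricData.exists_gaussMap : ∃ A κ m : ℂ, A ≠ 0 ∧ ‖κ‖ = 1 ∧ ‖m‖ < 1 ∧
    ∀ z : ℂ, ‖z‖ < 1 →
      analyticPart a y S T c k z * ((z ^ 2 - 1) * (z ^ 2 - a ^ 2)) = A * (1 - conj m * z) ^ 2 ∧
      analyticPart a (conj y) S T (-c) (-k) z =
        analyticPart a y S T c k z * (κ * ((z - m) / (1 - conj m * z))) ^ 2 := by
  have hlt := d.norm_coeff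
  have hsq := d.coeff₁_sq
  obtain ⟨e0, e1, e2⟩ := d.coeff_conj
  have hA : coeff₀ a y c k ≠ 0 := norm_pos_iff.1 ((norm_nonneg _).trans_lt hlt)
  generalize hA0 : coeff₀ a y c k = A at *
  generalize hA1 : coeff₁ a y S T = B at *
  generalize hA2 : coeff₂ a y c k = C at *
  have hA' : conj A ≠ 0 := (map_ne_zero _).2 hA
  have hn : (‖A‖ : ℂ) ≠ 0 := by exact_mod_cast norm_ne_zero_iff.2 hA
  -- Chosen so that `A + Bz + Cz² = A(1 - m̄z)²`.
  obtain ⟨m, hm⟩ : ∃ m : ℂ, conj m = -B / (2 * A) := ⟨conj (-B / (2 * A)), Complex.conj_conj _⟩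
  have hB : B = -2 * A * conj m := by rw [hm]; field_simp
  have hC : C = A * conj m ^ 2 := by
    apply mul_left_cancel₀ (mul_ne_zero (by norm_num : (4 : ℂ) ≠ 0) hA)
    rw [← hsq, hB]; ring
  have hB' : conj B = -2 * conj A * m := by
    rw [hB]; simp [Complex.conj_ofNat]
  have hC' : conj C = conj A * m ^ 2 := by rw [hC]; simp
  have hm1 : ‖m‖ < 1 := by
    have h1 : ‖A‖ * ‖m‖ ^ 2 < ‖A‖ * 1 := by
      rw [mul_one]
      convert hlt using 1
      rw [hC, norm_mul, norm_pow, RCLike.norm_conj]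
    have h2 := lt_of_mul_lt_mul_left h1 (norm_nonneg _)
    nlinarith [norm_nonneg m]
  -- The constant `κ` is a unimodular square root of `a² Ā / A`.
  refine ⟨A, a * conj A / ‖A‖, m, hA, ?_, hm1, fun z hz => ?_⟩
  · rw [norm_div, norm_mul, RCLike.norm_conj, d.norm_a_eq, Complex.norm_real, norm_norm, one_mul,
      div_self (norm_ne_zero_iff.2 hA)]
  · have hne : ∀ ζ : ℂ, ‖ζ‖ = 1 → ζ - z ≠ 0 := by
      intro ζ hζ h
      rw [sub_eq_zero.1 h] at hζ
      linarith
    have ha := d.norm_a_eq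
    have n1 := hne 1 norm_one
    have n2 := hne (-1) (by rw [norm_neg, norm_one])
    have n3 := hne a ha
    have n4 := hne (-a) (by rw [norm_neg, ha])
    have h1 := analyticPart_eq (y := y) (S := S) (T := T) (c := c) (k := k) n1 n2 n3 n4
    have h2 := analyticPart_eq (y := conj y) (S := S) (T := T) (c := -c) (k := -k) n1 n2 n3 n4
    rw [hA0, hA1, hA2] at h1
    rw [e0, e1, e2] at h2
    have h3 : analyticPart a y S T c k z * ((z ^ 2 - 1) * (z ^ 2 - a ^ 2)) =
        A * (1 - conj m * z) ^ 2 := by rw [h1, hB, hC]; ring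
    refine ⟨h3, ?_⟩
    have hP : (z ^ 2 - 1) * (z ^ 2 - a ^ 2) ≠ 0 := by
      have : (z ^ 2 - 1) * (z ^ 2 - a ^ 2) = (1 - z) * (-1 - z) * ((a - z) * (-a - z)) := by ring
      rw [this]
      exact mul_ne_zero (mul_ne_zero n1 n2) (mul_ne_zero n3 n4)
    apply mul_right_cancel₀ hP
    rw [h2, mul_right_comm (analyticPart a y S T c k z), h3, hB', hC']
    have n5 := one_sub_conj_mul_ne_zero hm1 hz
    have hAA : (‖A‖ : ℂ) ^ 2 = A * conj A := by rw [Complex.mul_conj']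
    rw [mul_pow, div_pow, div_pow, mul_mul_mul_comm A, mul_div_cancel₀ _ (pow_ne_zero 2 n5)]
    rw [mul_pow, hAA]
    field_simp
    ring

end

/-! ### The data seen from the zero of the projection -/

theorem one_sub_conj_mul_div {z ζ : ℂ} (h : ζ - z ≠ 0) :
    (1 - conj z * z) * (1 / (ζ - z)) = (1 - conj z * ζ) / (ζ - z) + conj z := by
  field_simp
  ring

/-- Up to the constant `z̄`, which later cancels, the normalized Cauchy kernel is a unit vector. -/
theorem one_sub_conj_mul_div_circleMap {z : ℂ} (hz : ‖z‖ < 1) (θ : ℝ) :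
    (1 - conj z * z) * (1 / (circleMap 0 1 θ - z)) = conj (centered z θ) + conj z := by
  rw [conj_centered hz, one_sub_conj_mul_div (circleMap_sub_ne_zero hz θ)]

theorem dot_self_of_norm {w : ℂ} (h : ‖w‖ = 1) : dot w w = 1 := by
  rw [dot, ← Complex.normSq_apply, Complex.normSq_eq_norm_sq, h, one_pow]

theorem dot_conj_centered {z : ℂ} (hz : ‖z‖ < 1) (a b : ℝ) :
    dot (conj (centered z a)) (conj (centered z b)) =
      cos (2 * (π * harmonicMeasure a b z)) := by
  have h := dot_self_of_norm (norm_centered hz a)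
  rw [centered_eq_mul_exp hz a b]
  have e : (2 * π * harmonicMeasure a b z * Complex.I : ℂ) =
      ((2 * (π * harmonicMeasure a b z) : ℝ) : ℂ) * Complex.I := by push_cast; ring
  rw [e, Complex.exp_mul_I, ← Complex.ofReal_cos, ← Complex.ofReal_sin]
  simp only [dot, Complex.conj_re, Complex.conj_im, Complex.mul_re, Complex.mul_im,
    Complex.add_re, Complex.add_im, Complex.ofReal_re, Complex.ofReal_im, Complex.I_re,
    Complex.I_im] at h ⊢
  linear_combination cos (2 * (π * harmonicMeasure a b z)) * h

section

variable {z : ℂ} {w₁ w₂ w₃ w₄ P₁ P₂ P₃ P₄ a r v : ℂ}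

/-- The shift `v` drops out because the differences of consecutive vertices sum to zero. -/
theorem mul_analyticPart {y S T c k : ℂ} (h₁ : r * (1 / (a - z)) = w₁ + v)
    (h₂ : r * (1 / (-1 - z)) = w₂ + v) (h₃ : r * (1 / (-a - z)) = w₃ + v)
    (h₄ : r * (1 / (1 - z)) = w₄ + v)
    (hP₁ : P₁ = y * (S + c * Complex.I)) (hP₂ : P₂ = -T - k * Complex.I)
    (hP₃ : P₃ = y * (S - c * Complex.I)) (hP₄ : P₄ = -T + k * Complex.I) :
    r * analyticPart a y S T c k z = Complex.I / (2 * π) *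
      ((P₁ - P₂) * w₁ + (P₂ - P₃) * w₂ + (P₃ - P₄) * w₃ + (P₄ - P₁) * w₄) := by
  rw [analyticPart, hP₁, hP₂, hP₃, hP₄]
  linear_combination Complex.I / (2 * π) * ((y * (S + c * Complex.I) - (-T - k * Complex.I)) * h₁
    + ((-T - k * Complex.I) - y * (S - c * Complex.I)) * h₂
    + (y * (S - c * Complex.I) - (-T + k * Complex.I)) * h₃
    + ((-T + k * Complex.I) - y * (S + c * Complex.I)) * h₄)

/-- The shift `v` drops out because the alternating sum of the side weights vanishes. -/
theorem mul_height_numerator {S T c k : ℂ} (h₁ : r * (1 / (a - z)) = w₁ + v)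
    (h₂ : r * (1 / (-1 - z)) = w₂ + v) (h₃ : r * (1 / (-a - z)) = w₃ + v)
    (h₄ : r * (1 / (1 - z)) = w₄ + v) (n₁ : a - z ≠ 0) (n₂ : -1 - z ≠ 0) (n₃ : -a - z ≠ 0)
    (n₄ : 1 - z ≠ 0) :
    r * ((a * (S * k - c * T) + (S * k + c * T)) * z ^ 2 + (a ^ 2 - 1) * (c + k) * z
        - a * (a * (S * k + c * T) + (S * k - c * T))) =
      -((z ^ 2 - 1) * (z ^ 2 - a ^ 2)) * (((c + k) + (S * k - c * T)) / 2 * w₁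
        - ((c + k) + (S * k + c * T)) / 2 * w₂ + ((c + k) - (S * k - c * T)) / 2 * w₃
        - ((c + k) - (S * k + c * T)) / 2 * w₄) := by
  have e₁ : w₁ = r * (1 / (a - z)) - v := by rw [h₁]; ring
  have e₂ : w₂ = r * (1 / (-1 - z)) - v := by rw [h₂]; ring
  have e₃ : w₃ = r * (1 / (-a - z)) - v := by rw [h₃]; ring
  have e₄ : w₄ = r * (1 / (1 - z)) - v := by rw [h₄]; ring
  have e : (z ^ 2 - 1) * (z ^ 2 - a ^ 2) = (1 - z) * (-1 - z) * (a - z) * (-a - z) := by ring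
  rw [e₁, e₂, e₃, e₄, e]
  field_simp
  ring

end

/-! ### Balance of the weights and the sharp lower bound -/

section

variable {S T c k : ℝ} {y a : ℂ} (d : BicentricData S T c k y a)
include d

/-- The vanishing of the weighted mean of the vertices determines the differences of opposite
weights. -/
theorem BicentricData.balance {x₁ x₂ x₃ x₄ : ℝ} (hx : x₁ + x₂ + x₃ + x₄ = π)
    (h : x₁ * (y * (S + c * Complex.I)) + x₂ * (-T - k * Complex.I)
      + x₃ * (y * (S - c * Complex.I)) + x₄ * (-T + k * Complex.I) = 0) :
    (x₂ - x₄) * (k * (c + k)) = S * ((π - (x₂ + x₄)) * (k * (c + k)) + π * T ^ 2) ∧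
    (x₃ - x₁) * (c * (c + k)) = T * ((x₂ + x₄) * (c * (c + k)) + π * S ^ 2) := by
  have hre := congrArg Complex.re h
  have him := congrArg Complex.im h
  simp at hre him
  have hμ : 0 < 1 + c * k := by have := mul_pos d.c_pos d.k_pos; linarith
  have r1 := d.sq_add_sq
  have r2 := d.sq_add_sq'
  have rr := d.re_y
  have ri := d.im_y
  have rn := d.norm_y
  constructor
  · have e : S * (x₁ + x₃) = y.re * (T * (x₂ + x₄)) + y.im * (k * (x₂ - x₄)) := by
      linear_combination y.re * hre + y.im * him - S * (x₁ + x₃) * rn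
    rw [← hx]
    linear_combination (-(1 + c * k)) * e + (-(T * (x₂ + x₄))) * rr - k * (x₂ - x₄) * ri
      - (S * (x₁ + x₃)) * r2
  · rw [← hx]
    linear_combination (1 + c * k) * hre - S * (x₁ + x₃) * rr - c * (x₃ - x₁) * ri
      - (T * (x₂ + x₄)) * r1

end

/-- The conformal factor at a zero of the harmonic extension, normalized by the hyperbolic
metric, is at least `√8 / π`. -/
theorem BicentricData.eight_le {S T c k α : ℝ} {y z : ℂ}
    (d : BicentricData S T c k y (circleMap 0 1 α)) (hα : 0 ≤ α) (hα' : α ≤ π) (hz : ‖z‖ < 1)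
    (h : harmonicMeasure 0 α z * (y * (S + c * Complex.I))
      + harmonicMeasure α π z * (-T - k * Complex.I)
      + harmonicMeasure π (π + α) z * (y * (S - c * Complex.I))
      + harmonicMeasure (π + α) (2 * π) z * (-T + k * Complex.I) = 0) :
    8 ≤ π ^ 2 * ((‖analyticPart (circleMap 0 1 α) y S T c k z‖
      + ‖analyticPart (circleMap 0 1 α) (conj y) S T (-c) (-k) z‖) * (1 - ‖z‖ ^ 2)) ^ 2 := by
  have hc := d.c_pos
  have hk := d.k_pos
  have hμ : 0 < 1 + c * k := by positivity
  have c1 : circleMap 0 1 π = -1 := by simp [circleMap_zero]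
  have c2 : circleMap 0 1 (2 * π) = 1 := by simp [circleMap_zero]
  have c3 : circleMap 0 1 (π + α) = -circleMap 0 1 α := by
    rw [circleMap_zero_one_add, c1]; ring
  -- The last arc ends where the first begins.
  have c4 : centered z (2 * π) = centered z 0 := by
    rw [centered, centered, c2]; simp [circleMap_zero]
  have q1 := one_sub_conj_mul_div_circleMap hz α
  have q2 := one_sub_conj_mul_div_circleMap hz π
  have q3 := one_sub_conj_mul_div_circleMap hz (π + α)
  have q4 := one_sub_conj_mul_div_circleMap hz (2 * π)
  have n1 := circleMap_sub_ne_zero hz α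
  have n2 := circleMap_sub_ne_zero hz π
  have n3 := circleMap_sub_ne_zero hz (π + α)
  have n4 := circleMap_sub_ne_zero hz (2 * π)
  have t1 := dot_conj_centered hz α π
  have t2 := dot_conj_centered hz π (π + α)
  have t3 := dot_conj_centered hz (π + α) (2 * π)
  have t4 := dot_conj_centered hz 0 α
  rw [← c4] at t4
  have u1 := dot_self_of_norm ((RCLike.norm_conj _).trans (norm_centered hz α))
  have u2 := dot_self_of_norm ((RCLike.norm_conj _).trans (norm_centered hz π))
  have u3 := dot_self_of_norm ((RCLike.norm_conj _).trans (norm_centered hz (π + α)))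
  have u4 := dot_self_of_norm ((RCLike.norm_conj _).trans (norm_centered hz (2 * π)))
  rw [c1] at q2 n2
  rw [c2] at q4 n4
  rw [c3] at q3 n3
  have hx : π * harmonicMeasure 0 α z + π * harmonicMeasure α π z
      + π * harmonicMeasure π (π + α) z + π * harmonicMeasure (π + α) (2 * π) z = π := by
    rw [← mul_add, ← mul_add, ← mul_add, harmonicMeasure_add _ _ _ hz, harmonicMeasure_add _ _ _ hz,
      harmonicMeasure_add _ _ _ hz, harmonicMeasure_full hz, mul_one]
  have p1 := mul_nonneg pi_pos.le (harmonicMeasure_nonneg hα hz)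
  have p2 := mul_nonneg pi_pos.le (harmonicMeasure_nonneg hα' hz)
  have p3 := mul_nonneg pi_pos.le (harmonicMeasure_nonneg (show π ≤ π + α by linarith) hz)
  have p4 := mul_nonneg pi_pos.le (harmonicMeasure_nonneg (show π + α ≤ 2 * π by linarith) hz)
  have hbal := d.balance hx (by push_cast; linear_combination π * h)
  generalize π * harmonicMeasure 0 α z = x₁ at *
  generalize π * harmonicMeasure α π z = x₂ at *
  generalize π * harmonicMeasure π (π + α) z = x₃ at *
  generalize π * harmonicMeasure (π + α) (2 * π) z = x₄ at *
  generalize conj (centered z α) = w₁ at *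
  generalize conj (centered z π) = w₂ at *
  generalize conj (centered z (π + α)) = w₃ at *
  generalize conj (centered z (2 * π)) = w₄ at *
  have hex := energyExcess_nonneg' hc hk d.sq_add_sq d.sq_add_sq' (Y := x₂ + x₄) (by linarith)
    (by linarith) hbal.1 hbal.2 (abs_le.2 ⟨by linarith, by linarith⟩)
    (abs_le.2 ⟨by linarith, by linarith⟩)
  obtain ⟨P₁, hP₁⟩ : ∃ P, P = y * (S + c * Complex.I) := ⟨_, rfl⟩
  obtain ⟨P₂, hP₂⟩ : ∃ P, P = (-T - k * Complex.I : ℂ) := ⟨_, rfl⟩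
  obtain ⟨P₃, hP₃⟩ : ∃ P, P = y * (S - c * Complex.I) := ⟨_, rfl⟩
  obtain ⟨P₄, hP₄⟩ : ∃ P, P = (-T + k * Complex.I : ℂ) := ⟨_, rfl⟩
  have hlow := d.energy_lower_bound hP₁ hP₂ hP₃ hP₄ u1 u2 u3 u4
  have eA := mul_analyticPart q1 q2 q3 q4 hP₁ hP₂ hP₃ hP₄
  have eB := mul_analyticPart (S := S) (T := T) (c := -c) (k := -k) (y := conj y) q1 q2 q3 q4
    (P₁ := conj P₁) (P₂ := conj P₂) (P₃ := conj P₃) (P₄ := conj P₄)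
    (by simp [hP₁]) (by simp [hP₂]) (by simp [hP₃]) (by simp [hP₄])
  have eC := mul_height_numerator (S := S) (T := T) (c := c) (k := k) q1 q2 q3 q4 n1 n2 n3 n4
  have hN := d.height_numerator z
  rw [← analyticPart_eq n4 n2 n1 n3, ← analyticPart_eq n4 n2 n1 n3] at hN
  have hr : 1 - conj z * z = ((1 - ‖z‖ ^ 2 : ℝ) : ℂ) := by
    rw [Complex.conj_mul']; push_cast; ring
  have hr0 : 0 < 1 - ‖z‖ ^ 2 := by nlinarith [norm_nonneg z]
  rw [hr] at eA eB eC
  have hR : (z ^ 2 - 1) * (z ^ 2 - circleMap 0 1 α ^ 2) ≠ 0 := by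
    have : (z ^ 2 - 1) * (z ^ 2 - circleMap 0 1 α ^ 2) =
      (1 - z) * (-1 - z) * ((circleMap 0 1 α - z) * (-circleMap 0 1 α - z)) := by ring
    rw [this]
    exact mul_ne_zero (mul_ne_zero n4 n2) (mul_ne_zero n1 n3)
  simp only [map_sub (starRingEnd ℂ), Complex.normSq_eq_norm_sq] at hlow
  push_cast at hlow
  generalize (z ^ 2 - 1) * (z ^ 2 - circleMap 0 1 α ^ 2) = R at *
  generalize analyticPart (circleMap 0 1 α) y S T c k z = H at *
  generalize analyticPart (circleMap 0 1 α) (conj y) S T (-c) (-k) z = G at *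
  generalize 1 - ‖z‖ ^ 2 = r at *
  generalize (P₁ - P₂) * w₁ + (P₂ - P₃) * w₂ + (P₃ - P₄) * w₃ + (P₄ - P₁) * w₄ = A at *
  generalize (conj P₁ - conj P₂) * w₁ + (conj P₂ - conj P₃) * w₂ + (conj P₃ - conj P₄) * w₃
    + (conj P₄ - conj P₁) * w₄ = B at *
  generalize ((c : ℂ) + k + (S * k - c * T)) / 2 * w₁ - (c + k + (S * k + c * T)) / 2 * w₂
    + (c + k - (S * k - c * T)) / 2 * w₃ - (c + k - (S * k + c * T)) / 2 * w₄ = C at *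
  generalize (circleMap 0 1 α * (S * k - c * T) + (S * k + c * T)) * z ^ 2
    + (circleMap 0 1 α ^ 2 - 1) * (c + k) * z
    - circleMap 0 1 α * (circleMap 0 1 α * (S * k + c * T) + (S * k - c * T)) = N at *
  have eC' : (((1 + c * k) * π ^ 2 * r ^ 2 : ℝ) : ℂ) * (H * G) = -C ^ 2 := by
    apply mul_right_cancel₀ (pow_ne_zero 2 hR)
    push_cast
    linear_combination (r : ℂ) ^ 2 * hN - (r * N - R * C) * eC
  have hpi : 0 < 2 * π := by positivity
  have sA : 2 * π * (r * ‖H‖) = ‖A‖ := by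
    have := congrArg norm eA
    simp only [norm_mul, norm_div, Complex.norm_I, Complex.norm_real, norm_of_nonneg hr0.le,
      Complex.norm_ofNat, norm_of_nonneg pi_pos.le] at this
    rw [this]; field_simp
  have sB : 2 * π * (r * ‖G‖) = ‖B‖ := by
    have := congrArg norm eB
    simp only [norm_mul, norm_div, Complex.norm_I, Complex.norm_real, norm_of_nonneg hr0.le,
      Complex.norm_ofNat, norm_of_nonneg pi_pos.le] at this
    rw [this]; field_simp
  have sC : (1 + c * k) * π ^ 2 * r ^ 2 * (‖H‖ * ‖G‖) = ‖C‖ ^ 2 := by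
    have := congrArg norm eC'
    rwa [norm_neg, norm_pow, norm_mul, norm_mul, Complex.norm_real,
      norm_of_nonneg (by positivity)] at this
  rw [← sA, ← sB, ← sC, t1, t2, t3, t4] at hlow
  have f2 : cos (2 * x₂) = cos (x₂ + x₄) * cos (x₂ - x₄) - sin (x₂ + x₄) * sin (x₂ - x₄) := by
    rw [← cos_add]; ring_nf
  have f4 : cos (2 * x₄) = cos (x₂ + x₄) * cos (x₂ - x₄) + sin (x₂ + x₄) * sin (x₂ - x₄) := by
    rw [← cos_sub]; ring_nf
  have f3 : cos (2 * x₃) = -cos (x₂ + x₄) * cos (x₃ - x₁) - sin (x₂ + x₄) * sin (x₃ - x₁) := by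
    rw [← cos_pi_sub, ← sin_pi_sub, ← cos_add, ← hx]; ring_nf
  have f1 : cos (2 * x₁) = -cos (x₂ + x₄) * cos (x₃ - x₁) + sin (x₂ + x₄) * sin (x₃ - x₁) := by
    rw [← cos_pi_sub, ← sin_pi_sub, ← cos_sub, ← hx]; ring_nf
  rw [f1, f2, f3, f4] at hlow
  rw [energyExcess] at hex
  -- The lower bound now reads `32(1 + ck) + 16 energyExcess`.
  refine le_of_mul_le_mul_left ?_ (show 0 < 4 * (1 + c * k) by positivity)
  linear_combination hlow + 16 * hex

/-! ### Conclusion for Scherk-type graphs -/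

theorem projection_eq (p q : ℝ) (z : ℂ) :
    projection p q z =
      harmonicMeasure 0 (arcParam p q) z * (bisector p q * ((cos (q - p) : ℝ)
        + (sin (q - p) : ℝ) * Complex.I))
      + harmonicMeasure (arcParam p q) π z * (-((-cos p : ℝ) : ℂ) - (sin p : ℝ) * Complex.I)
      + harmonicMeasure π (π + arcParam p q) z * (bisector p q * ((cos (q - p) : ℝ)
        - (sin (q - p) : ℝ) * Complex.I))
      + harmonicMeasure (π + arcParam p q) (2 * π) z *
        (-((-cos p : ℝ) : ℂ) + (sin p : ℝ) * Complex.I) := by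
  rw [projection, vertex₁_eq, vertex₂_eq, vertex₃_eq, vertex₄_eq]
  push_cast
  ring

/-- The pulled back curvature of a Scherk-type graph in terms of its conformal factor. -/
theorem curvature_mul_sq_conformalFactor {p q : ℝ} (hp : 0 < p) (hpq : p < q) (hq : q ≤ π)
    {u : ℂ → ℝ} (hu : IsScherkGraph p q u) {z : ℂ} (hz : ‖z‖ < 1) :
    slopeFactor u (projection p q z) ^ 2 * |gaussCurvature u (projection p q z)| *
      ((‖analyticPart (circleMap 0 1 (arcParam p q)) (bisector p q) (cos (q - p) : ℝ)
          (-cos p : ℝ) (sin (q - p) : ℝ) (sin p : ℝ) z‖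
        + ‖analyticPart (circleMap 0 1 (arcParam p q)) (conj (bisector p q)) (cos (q - p) : ℝ)
          (-cos p : ℝ) (-(sin (q - p) : ℝ)) (-(sin p : ℝ)) z‖) * (1 - ‖z‖ ^ 2)) ^ 2 = 4 := by
  have d := bicentricData hp hpq hq
  obtain ⟨A, κ, m, hA, hκ, hm, h⟩ := d.exists_gaussMap
  have hderiv := fun {ζ : ℂ} (hζ : ‖ζ‖ < 1) => hasFDerivAt_projection p q hζ
  simp only [← Complex.ofReal_neg (cos p)] at hderiv
  generalize circleMap 0 1 (arcParam p q) = a at *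
  generalize cos (q - p) = S at *
  generalize -cos p = T at *
  generalize sin (q - p) = c at *
  generalize sin p = k at *
  generalize bisector p q = y at *
  have hn : ∀ ζ : ℂ, ‖ζ‖ < 1 → 1 - conj m * ζ ≠ 0 := fun ζ hζ => one_sub_conj_mul_ne_zero hm hζ
  have hQn : ∀ ζ : ℂ, ‖κ * ((ζ - m) / (1 - conj m * ζ))‖ = ‖(ζ - m) / (1 - conj m * ζ)‖ := by
    intro ζ; rw [norm_mul, hκ, one_mul]
  have key := sq_slopeFactor_mul_abs_gaussCurvature (f := projection p q)
    (H := analyticPart a y S T c k) (Q := fun ζ => κ * ((ζ - m) / (1 - conj m * ζ))) (u := u)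
    (s := Metric.ball 0 1) (z := z) Metric.isOpen_ball (by simpa using hz)
    (fun ζ hζ => by
      have hζ' : ‖ζ‖ < 1 := by simpa using hζ
      rw [← (h ζ hζ').2]
      exact hderiv hζ')
    (fun ζ hζ h0 => by
      have hζ' : ‖ζ‖ < 1 := by simpa using hζ
      have h1 := (h ζ hζ').1
      rw [h0, zero_mul] at h1
      exact mul_ne_zero hA (pow_ne_zero 2 (hn ζ hζ')) h1.symm)
    (fun ζ hζ => by rw [hQn]; exact norm_mobius_lt_one hm (by simpa using hζ))
    ((hasDerivAt_mobius hm hz).const_mul κ)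
    (fun ζ hζ => hu.contDiffAt _ ⟨ζ, hζ, rfl⟩)
    hu.conformal
  have hr : 0 < 1 - ‖z‖ ^ 2 := by nlinarith [norm_nonneg z]
  have hm' : 0 ≤ 1 - ‖m‖ ^ 2 := by nlinarith [norm_nonneg m]
  -- Equality in the Schwarz–Pick lemma for a disk automorphism.
  have hQ' : (1 - ‖z‖ ^ 2) * ‖κ * (((1 - ‖m‖ ^ 2 : ℝ) : ℂ) / (1 - conj m * z) ^ 2)‖ =
      1 - ‖κ * ((z - m) / (1 - conj m * z))‖ ^ 2 := by
    rw [hQn, one_sub_sq_norm_mobius hm hz, norm_mul, hκ, one_mul, norm_div, norm_pow,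
      Complex.norm_real, norm_of_nonneg hm']
  have hlt : ‖κ * ((z - m) / (1 - conj m * z))‖ < 1 := by
    rw [hQn]; exact norm_mobius_lt_one hm hz
  have hnonneg := norm_nonneg (κ * ((z - m) / (1 - conj m * z)))
  rw [(h z hz).2, norm_mul, norm_pow]
  beta_reduce at key
  generalize ‖κ * ((z - m) / (1 - conj m * z))‖ = ρ at *
  generalize ‖κ * (((1 - ‖m‖ ^ 2 : ℝ) : ℂ) / (1 - conj m * z) ^ 2)‖ = δ at *
  have hpos : 0 < 1 - ρ ^ 2 := by nlinarith
  have hδ : δ ^ 2 ≠ 0 := pow_ne_zero 2 (pos_of_mul_pos_right (hQ' ▸ hpos) hr.le).ne'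
  apply mul_right_cancel₀ hδ
  rw [← key, ← hQ']
  ring

end Scherk

theorem theorem1p2 (p q : ℝ) (hpq : Scherk.Admissible p q)
    (u : ℂ → ℝ) (hu : Scherk.IsScherkGraph p q u) :
    Scherk.slopeFactor u 0 ^ 2 * |Scherk.gaussCurvature u 0| ≤ Real.pi ^ 2 / 2 := by
  obtain ⟨hp, hlt, hq, z, hz, hz0⟩ := hpq
  have hz1 : ‖z‖ < 1 := by simpa using hz
  have hcurv := Scherk.curvature_mul_sq_conformalFactor hp hlt hq hu hz1
  have hlow := (Scherk.bicentricData hp hlt hq).eight_le (Scherk.arcParam_pos hp hlt hq).le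
    (Scherk.arcParam_lt_pi p q).le hz1 ((Scherk.projection_eq p q z).symm.trans hz0)
  rw [hz0] at hcurv
  have h0 : 0 ≤ Scherk.slopeFactor u 0 ^ 2 * |Scherk.gaussCurvature u 0| := by positivity
  -- Inserting the curvature identity, with value `4`, leaves `8 W²|K| ≤ 4π²`.
  have h1 := mul_le_mul_of_nonneg_left hlow h0
  nlinarith

end
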